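/- Let $n\ge 2$ and $\sigma\in(\tfrac12,1)$. For a measurable set $E\subset\mathbb{R}^n$ and a measurable $u:\mathbb{R}^n\to\mathbb{R}$ put $$I_{n,\sigma,E}[u]=\iint_{E\times E}\frac{(u(x)-u(y))^2}{|x-y|^{n+2\sigma}}\,dx\,dy .$$ For an open set $\Omega\subset\mathbb{R}^n$ let $\mathring H^\sigma(\Omega)$ be the completion of $C^1_c(\Omega)$ with respect to the quadratic form $I_{n,\sigma,\Omega}$, regarded (through the fractional Sobolev embedding into $L^{2n/(n-2\sigma)}$) as a space of functions on $\mathbb{R}^n$, modulo null sets, that vanish outside $\Omega$. For $N>0$ let $$m(N)=\inf\left\{\frac{I_{n,\sigma,\{u>0\}}[u]}{\|u\|_{L^2(B_N)}^2}+|\{u>0\}|\;:\; u\in\mathring H^\sigma(B_N),\ u\not\equiv 0,\ u\ge 0 \text{ in } B_N\right\},$$ where $B_N=B_N(0)$ and $|\cdot|$ is Lebesgue measure. There are constants $c_*,R_*\in(0,1)$, depending only on $n$ and $\sigma$, with the following property. Let $N>0$, let $u$ be a (nonnegative) minimizer of $m(N)$ with $\int_{\mathbb{R}^n}u^2=1$,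 and let $x\in\mathbb{R}^n$ be a Lebesgue point of $\{u>0\}$, that is, $|\{u>0\}\cap B_r(x)|/|B_r(x)|\to 1$ as $r\to0^+$. Then there is some $R\in[R_*,1]$ such that $$\sup_{B_R(x)}u\ \ge\ c_*R^\sigma ,$$ where $\sup$ denotes the essential supremum. -/

import Mathlib

open MeasureTheory Filter Topology Set
open scoped ENNReal

noncomputable section

namespace FracFK

/-- The regional Gagliardo energy `I_{n,σ,E}[u] = ∬_{E×E} (u(x)-u(y))² / |x-y|^{n+2σ} dx dy`
of a function on `ℝⁿ`, for a (null-)measurable set `E`, with values in `[0,∞]`. -/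
def energy {n : ℕ} (σ : ℝ) (E : Set (EuclideanSpace ℝ (Fin n)))
    (u : EuclideanSpace ℝ (Fin n) → ℝ) : ℝ≥0∞ :=
  ∫⁻ x in E, ∫⁻ y in E,
    ENNReal.ofReal ((u x - u y) ^ 2 / ‖x - y‖ ^ ((n : ℝ) + 2 * σ))

/-- The class `C¹_c(Ω)`. -/
def IsTest {n : ℕ} (Ω : Set (EuclideanSpace ℝ (Fin n)))
    (φ : EuclideanSpace ℝ (Fin n) → ℝ) : Prop :=
  ContDiff ℝ 1 φ ∧ HasCompactSupport φ ∧ tsupport φ ⊆ Ω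

/-- The space `H̊^σ(Ω)`, the completion of `C¹_c(Ω)` with respect to the form `I_{n,σ,Ω}`,
realized as a space of functions on `ℝⁿ` (extended by zero outside `Ω`).
For `n ≥ 2` and `1/2 < σ < 1` the fractional Sobolev inequality
`‖φ‖²_{L^{2n/(n-2σ)}} ≤ C I_{n,σ,Ω}[φ]` holds on `C¹_c(Ω)`, so a sequence that is Cauchy for the
form converges in `L^{2n/(n-2σ)}(ℝⁿ)`; the elements of the completion are these limits.
Convergence of the form alone would not see additive constants when `Ω` is bounded. -/
def MemHo {n : ℕ} (σ : ℝ) (Ω : Set (EuclideanSpace ℝ (Fin n)))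
    (u : EuclideanSpace ℝ (Fin n) → ℝ) : Prop :=
  AEStronglyMeasurable u volume ∧
    ∃ φ : ℕ → EuclideanSpace ℝ (Fin n) → ℝ,
      (∀ k, IsTest Ω (φ k)) ∧
      Tendsto (fun k => energy σ Ω (φ k - u)) atTop (𝓝 0) ∧
      Tendsto (fun k => eLpNorm (φ k - u)
        (ENNReal.ofReal (2 * (n : ℝ) / ((n : ℝ) - 2 * σ))) volume) atTop (𝓝 0)

/-- Competitors for `m(N)`: `u ∈ H̊^σ(B_N)`, `u ≢ 0`, `u ≥ 0` in `B_N`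
(elements of `H̊^σ(B_N)` are functions up to null sets). -/
def Admissible {n : ℕ} (σ N : ℝ) (u : EuclideanSpace ℝ (Fin n) → ℝ) : Prop :=
  MemHo σ (Metric.ball 0 N) u ∧ ¬ (u =ᵐ[volume] 0) ∧
    ∀ᵐ x ∂(volume.restrict (Metric.ball 0 N)), 0 ≤ u x

/-- The functional `I_{n,σ,{u>0}}[u] / ‖u‖²_{L²(B_N)} + |{u>0}|`. For an admissible `u` the
denominator is neither `0` nor `∞`. -/
def functional {n : ℕ} (σ N : ℝ) (u : EuclideanSpace ℝ (Fin n) → ℝ) : ℝ≥0∞ :=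
  energy σ {x | 0 < u x} u / (∫⁻ x in Metric.ball 0 N, ENNReal.ofReal (u x ^ 2))
    + volume {x | 0 < u x}

/-- The infimum `m(N)`. -/
def m (n : ℕ) (σ N : ℝ) : ℝ≥0∞ :=
  sInf {a | ∃ u : EuclideanSpace ℝ (Fin n) → ℝ, Admissible σ N u ∧ a = functional σ N u}

/-- `u` is a minimizer of `m(N)`. -/
def IsMinimizer {n : ℕ} (σ N : ℝ) (u : EuclideanSpace ℝ (Fin n) → ℝ) : Prop :=
  Admissible σ N u ∧ functional σ N u = m n σ N

/-- `x` is a Lebesgue (density) point of the set `E`: `|E ∩ B_r(x)| / |B_r(x)| → 1` as `r → 0⁺`. -/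
def IsLebesguePoint {n : ℕ} (E : Set (EuclideanSpace ℝ (Fin n)))
    (x : EuclideanSpace ℝ (Fin n)) : Prop :=
  Tendsto (fun r : ℝ => volume (E ∩ Metric.ball x r) / volume (Metric.ball x r))
    (𝓝[>] 0) (𝓝 1)

/-- The supremum (up to null sets) of a nonnegative function `u` over `E`, with values in
`[0,∞]`. -/
def supOn {n : ℕ} (E : Set (EuclideanSpace ℝ (Fin n)))
    (u : EuclideanSpace ℝ (Fin n) → ℝ) : ℝ≥0∞ :=
  essSup (fun y => ENNReal.ofReal (u y)) (volume.restrict E)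

end FracFK

end

open MeasureTheory Filter Topology Set
open scoped ENNReal

namespace FracFK

/-! The radius can always be taken equal to `1`, and the proof is by contradiction: if `u ≤ c` a.e.
on the unit ball about `x`, with `c` small, then the positivity set has density at most `1/2` at `x`
along dyadic radii, so `x` is not a Lebesgue point.

The competitor is `u cos θ`, where `θ` is `π/2` on the ball of radius `r/2` and `0` off the ball of
radius `3r/4`. It vanishes on the smaller ball, so measure is saved there. Since `cos² + sin² = 1`,
the IMS formula (`energy_cos_add_energy_sin_le`) splits the energy up to a localization error, and
minimality (`gain`) bounds both the measure of `{u > 0}` in the half ball and the energy of `u sin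
θ` by that error plus the lost `L²` mass. The error is controlled by `r^(-2σ) U + V T`, where `U`
and `V` are the integrals of `u²` and `u` over the ball of radius `r`, and `T` is the nonlocal tail
of `u` outside it (`locError_le`).

The energy is regional, over the positivity set only. For `σ > 1/2` a Hardy inequality valid on
every measurable set (`exists_killing_le_energy`) recovers the interaction with the complement. It
yields a Faber–Krahn inequality (`exists_lintegral_sq_le_energy`) in which small support gives a
small constant. Applied to `u sin θ`, it bounds `U` at radius `r/2` (`exists_step`).

These estimates close up under halving of `r` in the form `U ≤ θ r^(n+2σ)`, measure `≤ α r^n`, `T ≤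
τ r^(-σ)`, where `θ` is now a number and `α` is at most half the volume of the unit ball
(`exists_density_le`). The constants require a bound on `m(N)`, which is uniform only for `N` away
from `0`. When `N < 1/2` the container lies in the unit ball about `x`, and the normalization alone
contradicts smallness (`one_le_of_ae_le`). -/

/-! ### The kernel: scaling, pointwise bounds, truncated integral. -/

/-- The Riesz-type kernel `|z|^{-p}`, with values in `[0,∞]`. -/
noncomputable def ker {n : ℕ} (p : ℝ) (z : EuclideanSpace ℝ (Fin n)) : ℝ≥0∞ :=
  ENNReal.ofReal ((‖z‖ ^ p)⁻¹)

@[fun_prop]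
theorem measurable_ker {n : ℕ} (p : ℝ) : Measurable (ker (n := n) p) := by
  unfold ker
  fun_prop

theorem ker_neg {n : ℕ} (p : ℝ) (z : EuclideanSpace ℝ (Fin n)) : ker p (-z) = ker p z := by
  simp [ker]

theorem ker_sub_comm {n : ℕ} (p : ℝ) (x y : EuclideanSpace ℝ (Fin n)) :
    ker p (x - y) = ker p (y - x) := by
  rw [← ker_neg, neg_sub]

theorem ker_smul {n : ℕ} (p : ℝ) {r : ℝ} (hr : 0 < r) (z : EuclideanSpace ℝ (Fin n)) :
    ker p (r • z) = ENNReal.ofReal (r ^ (-p)) * ker p z := by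
  unfold ker
  rw [← ENNReal.ofReal_mul (by positivity), norm_smul, Real.norm_of_nonneg hr.le,
    Real.mul_rpow hr.le (norm_nonneg _), mul_inv, Real.rpow_neg hr.le]

theorem ker_le_of_le_norm {n : ℕ} {p r : ℝ} (hp : 0 ≤ p) (hr : 0 < r)
    {z : EuclideanSpace ℝ (Fin n)} (hz : r ≤ ‖z‖) : ker p z ≤ ENNReal.ofReal (r ^ (-p)) := by
  unfold ker
  rw [Real.rpow_neg hr.le]
  apply ENNReal.ofReal_le_ofReal
  gcongr

/-- The origin is excluded because real inversion sends `0` to `0`: for `p ≠ 0` the kernel takes the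
value `0` there, not `∞`. -/
theorem le_ker_of_norm_le {n : ℕ} {p r : ℝ} (hp : 0 ≤ p)
    {z : EuclideanSpace ℝ (Fin n)} (hz0 : z ≠ 0) (hz : ‖z‖ ≤ r) :
    ENNReal.ofReal (r ^ (-p)) ≤ ker p z := by
  have hz0 : 0 < ‖z‖ := norm_pos_iff.2 hz0
  unfold ker
  rw [Real.rpow_neg (hz0.le.trans hz)]
  apply ENNReal.ofReal_le_ofReal
  gcongr

theorem energy_eq_lintegral_ker {n : ℕ} (σ : ℝ) (E : Set (EuclideanSpace ℝ (Fin n)))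
    (u : EuclideanSpace ℝ (Fin n) → ℝ) :
    energy σ E u = ∫⁻ x in E, ∫⁻ y in E,
      ENNReal.ofReal ((u x - u y) ^ 2) * ker ((n : ℝ) + 2 * σ) (x - y) := by
  unfold energy ker
  simp_rw [div_eq_mul_inv, ENNReal.ofReal_mul (sq_nonneg _)]

theorem lintegral_comp_smul {n : ℕ} {r : ℝ} (hr : 0 < r)
    {f : EuclideanSpace ℝ (Fin n) → ℝ≥0∞} (hf : Measurable f) :
    ∫⁻ z, f z = ENNReal.ofReal (r ^ n) * ∫⁻ z, f (r • z) := by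
  have h := Measure.map_addHaar_smul (volume : Measure (EuclideanSpace ℝ (Fin n))) hr.ne'
  have h2 : ∫⁻ z, f (r • z) = ∫⁻ z, f z ∂(Measure.map (r • ·) volume) := by
    rw [lintegral_map hf (by fun_prop)]
  rw [h2, h, lintegral_smul_measure, smul_eq_mul, ← mul_assoc, ← ENNReal.ofReal_mul (by positivity)]
  simp only [finrank_euclideanSpace, Fintype.card_fin]
  rw [abs_of_nonneg (by positivity), mul_inv_cancel₀ (by positivity)]
  simp

/-- The constant `∫ min(1,|z|²) |z|^{-(n+2σ)} dz`. -/
noncomputable def kerConst (n : ℕ) (σ : ℝ) : ℝ≥0∞ :=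
  ∫⁻ z : EuclideanSpace ℝ (Fin n), ENNReal.ofReal (min 1 (‖z‖ ^ 2)) * ker ((n : ℝ) + 2 * σ) z

/-- In polar coordinates the integrand is `t^(1-2σ)` near `0` and `t^(-1-2σ)` near infinity; these
are integrable since `σ < 1` and `σ > 0` respectively. -/
theorem kerConst_lt_top {n : ℕ} (hn : 2 ≤ n) {σ : ℝ} (hσ : 0 < σ) (hσ1 : σ < 1) :
    kerConst n σ < ⊤ := by
  have : Nontrivial (EuclideanSpace ℝ (Fin n)) := by
    have : Nonempty (Fin n) := ⟨⟨0, by omega⟩⟩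
    infer_instance
  have key : Integrable (fun z : EuclideanSpace ℝ (Fin n) =>
      (fun t : ℝ => min 1 (t ^ 2) * (t ^ ((n : ℝ) + 2 * σ))⁻¹) ‖z‖) := by
    refine (integrable_fun_norm_addHaar (volume : Measure (EuclideanSpace ℝ (Fin n)))
      (f := fun t : ℝ => min 1 (t ^ 2) * (t ^ ((n : ℝ) + 2 * σ))⁻¹)).2 ?_
    simp only [finrank_euclideanSpace, Fintype.card_fin, smul_eq_mul]
    have hIoc : IntegrableOn (fun t : ℝ => t ^ (1 - 2 * σ)) (Ioo 0 1) := by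
      rw [intervalIntegral.integrableOn_Ioo_rpow_iff one_pos]
      linarith
    have hIoi : IntegrableOn (fun t : ℝ => t ^ (-1 - 2 * σ)) (Ioi 1) :=
      integrableOn_Ioi_rpow_of_lt (by linarith) one_pos
    have e : ∀ t : ℝ, 0 < t → t ^ (n - 1) * (t ^ ((n : ℝ) + 2 * σ))⁻¹ = t ^ (-1 - 2 * σ) := by
      intro t ht
      rw [← Real.rpow_natCast, ← Real.rpow_neg ht.le, ← Real.rpow_add ht]
      congr 1
      rw [Nat.cast_sub (by omega)]
      push_cast
      ring
    have h1 : IntegrableOn (fun t : ℝ => t ^ (n - 1) *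
        (min 1 (t ^ 2) * (t ^ ((n : ℝ) + 2 * σ))⁻¹)) (Ioo 0 1) := by
      refine hIoc.congr_fun (fun t ht => ?_) measurableSet_Ioo
      simp only
      rw [min_eq_right (by nlinarith [ht.1, ht.2]), mul_left_comm, e t ht.1, ← Real.rpow_natCast,
        ← Real.rpow_add ht.1]
      congr 1
      push_cast
      ring
    have h2 : IntegrableOn (fun t : ℝ => t ^ (n - 1) *
        (min 1 (t ^ 2) * (t ^ ((n : ℝ) + 2 * σ))⁻¹)) (Ioi 1) := by
      refine hIoi.congr_fun (fun t ht => ?_) measurableSet_Ioi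
      have ht : 1 < t := ht
      simp only
      rw [min_eq_left (by nlinarith), one_mul, e t (by linarith)]
    have h3 : IntegrableOn (fun t : ℝ => t ^ (n - 1) *
        (min 1 (t ^ 2) * (t ^ ((n : ℝ) + 2 * σ))⁻¹)) (Ici 1) :=
      (integrableOn_Ici_iff_integrableOn_Ioi (μ := volume)).2 h2
    have := h1.union h3
    rwa [Ioo_union_Ici_eq_Ioi one_pos] at this
  have h := key.hasFiniteIntegral
  rw [hasFiniteIntegral_iff_ofReal (Eventually.of_forall fun z => by positivity)] at h
  unfold kerConst ker
  simp_rw [← ENNReal.ofReal_mul (show 0 ≤ min 1 (‖_‖ ^ 2) by positivity)]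
  exact h

theorem lintegral_min_mul_ker {n : ℕ} (σ : ℝ) {r : ℝ} (hr : 0 < r) :
    ∫⁻ z : EuclideanSpace ℝ (Fin n),
      ENNReal.ofReal (min 1 (‖z‖ ^ 2 / r ^ 2)) * ker ((n : ℝ) + 2 * σ) z
      = ENNReal.ofReal (r ^ (-(2 * σ))) * kerConst n σ := by
  rw [lintegral_comp_smul hr (by fun_prop)]
  simp_rw [ker_smul _ hr, norm_smul, Real.norm_of_nonneg hr.le, mul_pow]
  have : ∀ z : EuclideanSpace ℝ (Fin n), r ^ 2 * ‖z‖ ^ 2 / r ^ 2 = ‖z‖ ^ 2 := by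
    intro z; field_simp
  simp_rw [this, mul_left_comm _ (ENNReal.ofReal (r ^ (-((n : ℝ) + 2 * σ))))]
  rw [lintegral_const_mul _ (by fun_prop), ← mul_assoc, ← ENNReal.ofReal_mul (by positivity)]
  unfold kerConst
  congr 2
  rw [← Real.rpow_natCast, ← Real.rpow_add hr]
  congr 1
  ring

theorem lintegral_min_mul_ker_sub {n : ℕ} (σ : ℝ) {r : ℝ} (hr : 0 < r)
    (x : EuclideanSpace ℝ (Fin n)) :
    ∫⁻ y : EuclideanSpace ℝ (Fin n),
      ENNReal.ofReal (min 1 (‖x - y‖ ^ 2 / r ^ 2)) * ker ((n : ℝ) + 2 * σ) (x - y)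
      = ENNReal.ofReal (r ^ (-(2 * σ))) * kerConst n σ := by
  rw [← lintegral_min_mul_ker σ hr]
  exact lintegral_sub_left_eq_self
    (fun z => ENNReal.ofReal (min 1 (‖z‖ ^ 2 / r ^ 2)) * ker ((n : ℝ) + 2 * σ) z) x

/-! ### Hardy-type inequality through midpoints. -/

theorem ennreal_le_of_le_mul_add {X Y : ℝ≥0∞} {q : ℝ} (hq0 : 0 ≤ q) (hq : q < 1) (hX : X ≠ ⊤)
    (h : X ≤ ENNReal.ofReal q * X + Y) : X ≤ ENNReal.ofReal ((1 - q)⁻¹) * Y := by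
  have hpos : 0 < (1 - q)⁻¹ := inv_pos.2 (by linarith)
  rcases eq_or_ne Y ⊤ with rfl | hY
  · rw [ENNReal.mul_top (by simpa using hpos)]
    exact le_top
  lift X to NNReal using hX
  lift Y to NNReal using hY
  have h' : (X : ℝ) ≤ q * X + Y := by
    have := ENNReal.toReal_mono (by finiteness) h
    rwa [ENNReal.toReal_add (by finiteness) (by finiteness), ENNReal.toReal_mul,
      ENNReal.toReal_ofReal hq0] at this
  rw [← ENNReal.ofReal_coe_nnreal, ← ENNReal.ofReal_coe_nnreal, ← ENNReal.ofReal_mul hpos.le]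
  apply ENNReal.ofReal_le_ofReal
  rw [inv_mul_eq_div, le_div_iff₀ (by linarith)]
  linarith

/-- The killing part `∬_{A×Aᶜ} w(x)² |x-y|^{-(n+2σ)} dx dy` of the full Gagliardo energy. -/
noncomputable def killing {n : ℕ} (σ : ℝ) (A : Set (EuclideanSpace ℝ (Fin n)))
    (w : EuclideanSpace ℝ (Fin n) → ℝ) : ℝ≥0∞ :=
  ∫⁻ x in A, ∫⁻ y in Aᶜ, ENNReal.ofReal (w x ^ 2) * ker ((n : ℝ) + 2 * σ) (x - y)

theorem lintegral_lintegral_add {α β : Type*} [MeasurableSpace α] [MeasurableSpace β]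
    {μ : Measure α} {ν : Measure β} [SFinite ν] {f g : α → β → ℝ≥0∞}
    (hf : Measurable (Function.uncurry f)) :
    ∫⁻ x, ∫⁻ y, (f x y + g x y) ∂ν ∂μ = ∫⁻ x, ∫⁻ y, f x y ∂ν ∂μ + ∫⁻ x, ∫⁻ y, g x y ∂ν ∂μ := by
  have h1 : Measurable fun x => ∫⁻ y, f x y ∂ν := hf.lintegral_prod_right'
  rw [← lintegral_add_left h1]
  congr 1 with x
  exact lintegral_add_left (hf.comp measurable_prodMk_left) _

theorem lintegral_lintegral_const_mul {α β : Type*} [MeasurableSpace α] [MeasurableSpace β]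
    {μ : Measure α} {ν : Measure β} [SFinite ν] {f : α → β → ℝ≥0∞} (c : ℝ≥0∞)
    (hf : Measurable (Function.uncurry f)) :
    ∫⁻ x, ∫⁻ y, c * f x y ∂ν ∂μ = c * ∫⁻ x, ∫⁻ y, f x y ∂ν ∂μ := by
  have h1 : Measurable fun x => ∫⁻ y, f x y ∂ν := hf.lintegral_prod_right'
  rw [← lintegral_const_mul c h1]
  congr 1 with x
  exact lintegral_const_mul c (hf.comp measurable_prodMk_left)

theorem lintegral_comp_midpoint {n : ℕ} {f : EuclideanSpace ℝ (Fin n) → ℝ≥0∞} (hf : Measurable f)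
    (x : EuclideanSpace ℝ (Fin n)) :
    ∫⁻ y, f ((1 / 2 : ℝ) • (x + y)) = ENNReal.ofReal (2 ^ n) * ∫⁻ z, f z := by
  rw [lintegral_comp_smul (r := 2) two_pos (f := fun y => f ((1 / 2 : ℝ) • (x + y)))
    (hf.comp (by fun_prop)), ← lintegral_add_left_eq_self f ((1 / 2 : ℝ) • x)]
  congr 3 with z
  congr 1
  module

theorem lintegral_lintegral_comp_midpoint_right {n : ℕ}
    {f : EuclideanSpace ℝ (Fin n) → EuclideanSpace ℝ (Fin n) → ℝ≥0∞}
    (hf : Measurable (Function.uncurry f)) :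
    ∫⁻ x, ∫⁻ y, f x ((1 / 2 : ℝ) • (x + y)) = ENNReal.ofReal (2 ^ n) * ∫⁻ x, ∫⁻ y, f x y := by
  have h1 : Measurable fun x => ∫⁻ y, f x y := hf.lintegral_prod_right'
  rw [← lintegral_const_mul _ h1]
  congr 1 with x
  exact lintegral_comp_midpoint (hf.comp measurable_prodMk_left) x

theorem lintegral_lintegral_comp_midpoint_left {n : ℕ}
    {f : EuclideanSpace ℝ (Fin n) → EuclideanSpace ℝ (Fin n) → ℝ≥0∞}
    (hf : Measurable (Function.uncurry f)) :
    ∫⁻ x, ∫⁻ y, f ((1 / 2 : ℝ) • (x + y)) y = ENNReal.ofReal (2 ^ n) * ∫⁻ x, ∫⁻ y, f x y := by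
  have hm : Measurable fun q : EuclideanSpace ℝ (Fin n) × EuclideanSpace ℝ (Fin n) =>
      ((1 / 2 : ℝ) • (q.1 + q.2), q.2) := by fun_prop
  have hm2 : Measurable (Function.uncurry fun x y => f ((1 / 2 : ℝ) • (x + y)) y) := hf.comp hm
  rw [lintegral_lintegral_swap hm2.aemeasurable,
    lintegral_lintegral_swap hf.aemeasurable,
    ← lintegral_lintegral_comp_midpoint_right (f := fun y x => f x y) (hf.comp measurable_swap)]
  simp_rw [add_comm]

theorem setLIntegral_setLIntegral_eq_indicator {n : ℕ} {A B : Set (EuclideanSpace ℝ (Fin n))}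
    (hA : MeasurableSet A) (hB : MeasurableSet B)
    (f : EuclideanSpace ℝ (Fin n) → EuclideanSpace ℝ (Fin n) → ℝ≥0∞) :
    ∫⁻ x in A, ∫⁻ y in B, f x y = ∫⁻ x, ∫⁻ y, A.indicator 1 x * B.indicator 1 y * f x y := by
  rw [← lintegral_indicator hA]
  congr 1 with x
  by_cases hx : x ∈ A
  · simp only [hx, indicator_of_mem, Pi.one_apply, one_mul]
    rw [← lintegral_indicator hB]
    congr 1 with y
    by_cases hy : y ∈ B <;> simp [hy]
  · simp [hx]

/-- Hardy-type inequality on an arbitrary measurable set: for `σ > 1/2` the killing part of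
the full energy is controlled by the regional energy, provided that it is finite. -/
theorem exists_killing_le_energy (n : ℕ) {σ : ℝ} (hσ : 1 / 2 < σ) :
    ∃ C : ℝ, 0 < C ∧ ∀ A : Set (EuclideanSpace ℝ (Fin n)), MeasurableSet A →
      ∀ w : EuclideanSpace ℝ (Fin n) → ℝ, Measurable w → killing σ A w ≠ ⊤ →
        killing σ A w ≤ ENNReal.ofReal C * energy σ A w := by
  -- Replacing an endpoint by the midpoint costs `2^(-p)` from the kernel and gains `2^n` from the
  -- Jacobian, in total `q₀`. The condition `σ > 1/2` is exactly `q₀ < 1/2`.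
  set q₀ : ℝ := 2 ^ (-(2 * σ)) with hq₀
  have hq₀pos : 0 < q₀ := by positivity
  have hq₀lt : q₀ < 1 / 2 := by
    have : (2 : ℝ) ^ (-(2 * σ)) < 2 ^ (-1 : ℝ) :=
      Real.rpow_lt_rpow_of_exponent_lt (by norm_num) (by linarith)
    rw [Real.rpow_neg_one] at this
    linarith
  -- Chosen so that `(1 + e) q₀ = 1/2`; the killing term then returns with coefficient `1/2 + q₀ <
  -- 1`.
  set e : ℝ := 1 / (2 * q₀) - 1 with he
  have hepos : 0 < e := by
    rw [he, sub_pos, lt_div_iff₀ (by positivity)]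
    linarith
  have hq : q₀ + (1 + e) * q₀ = 1 / 2 + q₀ := by
    rw [he]; field_simp; ring
  refine ⟨(1 - (1 / 2 + q₀))⁻¹ * ((1 + 1 / e) * q₀),
    mul_pos (inv_pos.2 (by linarith)) (by positivity), fun A hA w hw hfin => ?_⟩
  set p : ℝ := (n : ℝ) + 2 * σ with hp
  set a : EuclideanSpace ℝ (Fin n) → ℝ≥0∞ := A.indicator 1 with ha
  set b : EuclideanSpace ℝ (Fin n) → ℝ≥0∞ := Aᶜ.indicator 1 with hb
  have hma : Measurable a := measurable_one.indicator hA
  have hmb : Measurable b := measurable_one.indicator hA.compl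
  set F : EuclideanSpace ℝ (Fin n) → EuclideanSpace ℝ (Fin n) → ℝ≥0∞ :=
    fun x y => a x * b y * (ENNReal.ofReal (w x ^ 2) * ker p (x - y)) with hF
  set G : EuclideanSpace ℝ (Fin n) → EuclideanSpace ℝ (Fin n) → ℝ≥0∞ :=
    fun x y => a x * a y * (ENNReal.ofReal ((w x - w y) ^ 2) * ker p (x - y)) with hG
  have hXF : killing σ A w = ∫⁻ x, ∫⁻ y, F x y :=
    setLIntegral_setLIntegral_eq_indicator hA hA.compl _
  have hIG : energy σ A w = ∫⁻ x, ∫⁻ y, G x y := by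
    rw [energy_eq_lintegral_ker]
    exact setLIntegral_setLIntegral_eq_indicator hA hA _
  have hmF : Measurable (Function.uncurry F) := by
    simp only [hF, Function.uncurry_def]; fun_prop
  have hmG : Measurable (Function.uncurry G) := by
    simp only [hG, Function.uncurry_def]; fun_prop
  have hk1 : ∀ x y : EuclideanSpace ℝ (Fin n),
      ker p (x - y) = ENNReal.ofReal (2 ^ (-p)) * ker p (x - (1 / 2 : ℝ) • (x + y)) := by
    intro x y
    rw [← ker_smul p two_pos]
    congr 1
    module
  have hk2 : ∀ x y : EuclideanSpace ℝ (Fin n),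
      ker p (x - y) = ENNReal.ofReal (2 ^ (-p)) * ker p ((1 / 2 : ℝ) • (x + y) - y) := by
    intro x y
    rw [← ker_smul p two_pos]
    congr 1
    module
  have hcq : ENNReal.ofReal (2 ^ (-p)) * ENNReal.ofReal (2 ^ n) = ENNReal.ofReal q₀ := by
    rw [← ENNReal.ofReal_mul (by positivity), ← Real.rpow_natCast, ← Real.rpow_add two_pos]
    congr 2
    rw [hp]; ring
  -- For `x ∈ A`, `y ∉ A` with midpoint `z`: if `z ∉ A`, the pair `(x, z)` is again of killing type.
  -- If `z ∈ A`, then `w x` is compared with `w z`, which gives the killing pair `(z, y)` and the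
  -- regional pair `(x, z)`.
  have hpt : ∀ x y, F x y ≤ ENNReal.ofReal (2 ^ (-p)) * F x ((1 / 2 : ℝ) • (x + y))
      + (ENNReal.ofReal ((1 + e) * 2 ^ (-p)) * F ((1 / 2 : ℝ) • (x + y)) y
      + ENNReal.ofReal ((1 + 1 / e) * 2 ^ (-p)) * G x ((1 / 2 : ℝ) • (x + y))) := by
    intro x y
    by_cases hx : x ∈ A
    swap
    · simp [hF, ha, hx]
    by_cases hy : y ∈ A
    · simp [hF, hb, hy]
    by_cases hz : (1 / 2 : ℝ) • (x + y) ∈ A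
    · refine le_trans ?_ le_add_self
      simp only [hF, hG, ha, hb, hx, hy, hz, indicator_of_mem, mem_compl_iff, not_false_eq_true,
        Pi.one_apply, one_mul]
      have hx2 := hk1 x y
      have hy2 := hk2 x y
      generalize (1 / 2 : ℝ) • (x + y) = z at *
      have hsq : w x ^ 2 ≤ (1 + e) * w z ^ 2 + (1 + 1 / e) * (w x - w z) ^ 2 := by
        have h0 : (1 + e) * w z ^ 2 + (1 + 1 / e) * (w x - w z) ^ 2 - w x ^ 2
            = (e * w z - (w x - w z)) ^ 2 / e := by
          field_simp; ring
        have h1 : 0 ≤ (e * w z - (w x - w z)) ^ 2 / e := by positivity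
        linarith
      calc ENNReal.ofReal (w x ^ 2) * ker p (x - y)
          ≤ ENNReal.ofReal ((1 + e) * w z ^ 2 + (1 + 1 / e) * (w x - w z) ^ 2)
            * ker p (x - y) := by gcongr
        _ = ENNReal.ofReal (1 + e) * ENNReal.ofReal (w z ^ 2) * ker p (x - y)
            + ENNReal.ofReal (1 + 1 / e) * ENNReal.ofReal ((w x - w z) ^ 2) * ker p (x - y) := by
            rw [ENNReal.ofReal_add (by positivity) (by positivity),
              ENNReal.ofReal_mul (by positivity), ENNReal.ofReal_mul (by positivity), add_mul]
        _ = _ := by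
            nth_rewrite 1 [hy2]
            rw [hx2, ENNReal.ofReal_mul (by positivity), ENNReal.ofReal_mul (by positivity)]
            ring
    · refine le_trans ?_ le_self_add
      simp only [hF, ha, hb, hx, hy, hz, indicator_of_mem, mem_compl_iff, not_false_eq_true,
        Pi.one_apply, one_mul]
      rw [hk1 x y, mul_left_comm]
  have hmid : Measurable fun q : EuclideanSpace ℝ (Fin n) × EuclideanSpace ℝ (Fin n) =>
      (1 / 2 : ℝ) • (q.1 + q.2) := by fun_prop
  have m1 : Measurable (Function.uncurry fun x y => F x ((1 / 2 : ℝ) • (x + y))) :=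
    hmF.comp (measurable_fst.prodMk hmid)
  have m2 : Measurable (Function.uncurry fun x y => F ((1 / 2 : ℝ) • (x + y)) y) :=
    hmF.comp (hmid.prodMk measurable_snd)
  have m3 : Measurable (Function.uncurry fun x y => G x ((1 / 2 : ℝ) • (x + y))) :=
    hmG.comp (measurable_fst.prodMk hmid)
  have hcq' : ∀ c : ℝ, 0 ≤ c → ∀ Y : ℝ≥0∞, ENNReal.ofReal (c * 2 ^ (-p)) *
      (ENNReal.ofReal (2 ^ n) * Y) = ENNReal.ofReal (c * q₀) * Y := by
    intro c hc Y
    rw [← mul_assoc, ENNReal.ofReal_mul hc, mul_assoc (ENNReal.ofReal c), hcq,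
      ← ENNReal.ofReal_mul hc]
  rw [ENNReal.ofReal_mul (inv_pos.2 (by linarith)).le, mul_assoc]
  -- The killing term occurs on both sides, so absorbing it requires finiteness.
  refine ennreal_le_of_le_mul_add (by positivity) (by linarith) hfin ?_
  calc killing σ A w = ∫⁻ x, ∫⁻ y, F x y := hXF
    _ ≤ ∫⁻ x, ∫⁻ y, (ENNReal.ofReal (2 ^ (-p)) * F x ((1 / 2 : ℝ) • (x + y))
      + (ENNReal.ofReal ((1 + e) * 2 ^ (-p)) * F ((1 / 2 : ℝ) • (x + y)) y
      + ENNReal.ofReal ((1 + 1 / e) * 2 ^ (-p)) * G x ((1 / 2 : ℝ) • (x + y)))) := by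
        gcongr with x y; exact hpt x y
    _ = ENNReal.ofReal q₀ * killing σ A w + (ENNReal.ofReal ((1 + e) * q₀) * killing σ A w
        + ENNReal.ofReal ((1 + 1 / e) * q₀) * energy σ A w) := by
        rw [lintegral_lintegral_add (m1.const_mul _), lintegral_lintegral_add (m2.const_mul _),
          lintegral_lintegral_const_mul _ m1, lintegral_lintegral_const_mul _ m2,
          lintegral_lintegral_const_mul _ m3, lintegral_lintegral_comp_midpoint_right hmF,
          lintegral_lintegral_comp_midpoint_left hmF, lintegral_lintegral_comp_midpoint_right hmG,
          hcq' _ (by positivity), hcq' _ (by positivity), ← mul_assoc, hcq, ← hXF, ← hIG]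
    _ = ENNReal.ofReal (1 / 2 + q₀) * killing σ A w
        + ENNReal.ofReal ((1 + 1 / e) * q₀) * energy σ A w := by
        rw [← add_assoc, ← add_mul, ← ENNReal.ofReal_add hq₀pos.le (by positivity), hq]

theorem killing_le_energy_univ {n : ℕ} {σ : ℝ} {A : Set (EuclideanSpace ℝ (Fin n))}
    (hA : MeasurableSet A) {w : EuclideanSpace ℝ (Fin n) → ℝ} (hw : ∀ x ∉ A, w x = 0) :
    killing σ A w ≤ energy σ univ w := by
  rw [energy_eq_lintegral_ker, killing]
  calc _ = ∫⁻ x in A, ∫⁻ y in Aᶜ,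
        ENNReal.ofReal ((w x - w y) ^ 2) * ker ((n : ℝ) + 2 * σ) (x - y) := by
        congr 1 with x
        refine setLIntegral_congr_fun hA.compl fun y hy => ?_
        simp [hw y hy]
    _ ≤ _ := by
        refine (lintegral_mono_set (subset_univ _)).trans (lintegral_mono fun x => ?_)
        exact lintegral_mono_set (subset_univ _)

/-! ### Faber–Krahn inequality on sets of small measure. -/

theorem volume_ball_eq {n : ℕ} (x : EuclideanSpace ℝ (Fin n)) {r : ℝ} (hr : 0 < r) :
    volume (Metric.ball x r) = ENNReal.ofReal (r ^ n)
      * volume (Metric.ball (0 : EuclideanSpace ℝ (Fin n)) 1) := by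
  have := Measure.addHaar_ball_of_pos (volume : Measure (EuclideanSpace ℝ (Fin n))) x hr
  simpa using this

/-- The Lebesgue measure of the unit ball. -/
noncomputable def unitVol (n : ℕ) : ℝ :=
  (volume (Metric.ball (0 : EuclideanSpace ℝ (Fin n)) 1)).toReal

theorem unitVol_pos (n : ℕ) : 0 < unitVol n :=
  ENNReal.toReal_pos (Metric.measure_ball_pos _ _ one_pos).ne' measure_ball_lt_top.ne

theorem volume_ball_eq_ofReal {n : ℕ} (x : EuclideanSpace ℝ (Fin n)) {r : ℝ} (hr : 0 < r) :
    volume (Metric.ball x r) = ENNReal.ofReal (r ^ n * unitVol n) := by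
  rw [volume_ball_eq x hr, ENNReal.ofReal_mul (by positivity), unitVol,
    ENNReal.ofReal_toReal measure_ball_lt_top.ne]

/-- Faber–Krahn inequality for the regional energy on sets of small measure. -/
theorem exists_lintegral_sq_le_energy (n : ℕ) {σ : ℝ} (hσ : 1 / 2 < σ) :
    ∃ C : ℝ, 0 < C ∧ ∀ A : Set (EuclideanSpace ℝ (Fin n)), MeasurableSet A →
      ∀ w : EuclideanSpace ℝ (Fin n) → ℝ, Measurable w → energy σ univ w ≠ ⊤ →
        (∀ x ∉ A, w x = 0) → ∀ ρ : ℝ, 0 < ρ →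
        volume A ≤ ENNReal.ofReal (ρ ^ n * unitVol n / 2) →
        ∫⁻ x, ENNReal.ofReal (w x ^ 2) ≤ ENNReal.ofReal (C * ρ ^ (2 * σ)) * energy σ A w := by
  obtain ⟨C, hC, H⟩ := exists_killing_le_energy n hσ
  have hω := unitVol_pos n
  refine ⟨2 / unitVol n * C, by positivity, fun A hA w hw hfin h0 ρ hρ hvol => ?_⟩
  have hk := H A hA w hw
    (ne_top_of_le_ne_top hfin (killing_le_energy_univ hA h0))
  set c : ℝ := ρ ^ (-(2 * σ)) * unitVol n / 2 with hc
  have hcpos : 0 < c := by positivity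
  -- At least half of the ball of radius `ρ` about `x` lies outside `A`, and the kernel is at least
  -- `ρ^(-(n+2σ))` there. Hence the killing weight is bounded below on `A`, and Hardy's inequality
  -- finishes the proof.
  have hker : ∀ x ∈ A, ENNReal.ofReal c ≤ ∫⁻ y in Aᶜ, ker ((n : ℝ) + 2 * σ) (x - y) := by
    intro x hx
    have hB : ENNReal.ofReal (ρ ^ n * unitVol n / 2) ≤ volume (Metric.ball x ρ \ A) := by
      refine le_trans ?_ le_measure_sdiff
      rw [volume_ball_eq_ofReal x hρ]
      refine le_trans ?_ (tsub_le_tsub_left hvol _)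
      rw [← ENNReal.ofReal_sub _ (by positivity)]
      apply ENNReal.ofReal_le_ofReal
      linarith
    calc ENNReal.ofReal c = ENNReal.ofReal (ρ ^ (-((n : ℝ) + 2 * σ)))
          * ENNReal.ofReal (ρ ^ n * unitVol n / 2) := by
          rw [← ENNReal.ofReal_mul (by positivity), hc, neg_add, Real.rpow_add hρ,
            Real.rpow_neg hρ.le (n : ℝ), Real.rpow_natCast]
          congr 1
          field_simp
      _ ≤ ENNReal.ofReal (ρ ^ (-((n : ℝ) + 2 * σ))) * volume (Metric.ball x ρ \ A) := by gcongr
      _ = ∫⁻ y in Metric.ball x ρ \ A, ENNReal.ofReal (ρ ^ (-((n : ℝ) + 2 * σ))) := by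
          rw [setLIntegral_const]
      _ ≤ ∫⁻ y in Metric.ball x ρ \ A, ker ((n : ℝ) + 2 * σ) (x - y) := by
          refine setLIntegral_mono (by fun_prop) fun y hy => ?_
          refine le_ker_of_norm_le (by positivity) ?_ ?_
          · rintro h
            exact hy.2 (sub_eq_zero.1 h ▸ hx)
          · rw [← dist_eq_norm, dist_comm]
            exact (Metric.mem_ball.1 hy.1).le
      _ ≤ ∫⁻ y in Aᶜ, ker ((n : ℝ) + 2 * σ) (x - y) :=
          lintegral_mono_set fun y hy => hy.2
  have h1 : ENNReal.ofReal c * ∫⁻ x, ENNReal.ofReal (w x ^ 2) ≤ killing σ A w := by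
    rw [← setLIntegral_eq_of_support_subset (s := A), ← lintegral_const_mul _ (by fun_prop)]
    · refine setLIntegral_mono' hA fun x hx => ?_
      rw [lintegral_const_mul _ (by fun_prop), mul_comm]
      gcongr
      exact hker x hx
    · intro x hx
      by_contra hxA
      simp [h0 x hxA] at hx
  have h2 : ∫⁻ x, ENNReal.ofReal (w x ^ 2) ≤ ENNReal.ofReal c⁻¹ * killing σ A w := by
    refine le_trans (le_of_eq ?_) (mul_le_mul_right h1 (ENNReal.ofReal c⁻¹))
    rw [← mul_assoc, ← ENNReal.ofReal_mul (by positivity), inv_mul_cancel₀ hcpos.ne']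
    simp
  refine h2.trans ((mul_le_mul_right hk _).trans (le_of_eq ?_))
  rw [← mul_assoc, ← ENNReal.ofReal_mul (by positivity)]
  congr 2
  rw [hc, Real.rpow_neg hρ.le]
  field_simp

/-! ### Elementary energy bounds; test functions have finite full energy. -/

theorem energy_mono_set {n : ℕ} {σ : ℝ} {E F : Set (EuclideanSpace ℝ (Fin n))} (h : E ⊆ F)
    (u : EuclideanSpace ℝ (Fin n) → ℝ) : energy σ E u ≤ energy σ F u :=
  (lintegral_mono_set h).trans (lintegral_mono fun _ => lintegral_mono_set h)

theorem measurable_energy_integrand {n : ℕ} {f : EuclideanSpace ℝ (Fin n) → ℝ} (hf : Measurable f)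
    (p : ℝ) : Measurable (Function.uncurry fun x y : EuclideanSpace ℝ (Fin n) =>
      ENNReal.ofReal ((f x - f y) ^ 2) * ker p (x - y)) := by
  simp only [Function.uncurry_def]
  fun_prop

theorem energy_sub_le {n : ℕ} {σ : ℝ} (E : Set (EuclideanSpace ℝ (Fin n)))
    {f g : EuclideanSpace ℝ (Fin n) → ℝ} (hf : Measurable f) (hg : Measurable g) :
    energy σ E (f - g) ≤ 2 * energy σ E f + 2 * energy σ E g := by
  simp_rw [energy_eq_lintegral_ker]
  have mf := measurable_energy_integrand hf ((n : ℝ) + 2 * σ)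
  have mg := measurable_energy_integrand hg ((n : ℝ) + 2 * σ)
  rw [← lintegral_lintegral_const_mul 2 mf, ← lintegral_lintegral_const_mul 2 mg,
    ← lintegral_lintegral_add (mf.const_mul 2)]
  refine lintegral_mono fun x => lintegral_mono fun y => ?_
  simp only [Pi.sub_apply]
  rw [← mul_assoc, ← mul_assoc, ← add_mul]
  gcongr
  rw [← ENNReal.ofReal_ofNat 2, ← ENNReal.ofReal_mul (by norm_num),
    ← ENNReal.ofReal_mul (by norm_num), ← ENNReal.ofReal_add (by positivity) (by positivity)]
  apply ENNReal.ofReal_le_ofReal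
  nlinarith [sq_nonneg (f x - f y + (g x - g y))]

/-- Multiplication by a bounded Lipschitz function is bounded for the regional energy. -/
theorem energy_mul_le {n : ℕ} {σ : ℝ} (E : Set (EuclideanSpace ℝ (Fin n)))
    {f ψ : EuclideanSpace ℝ (Fin n) → ℝ} (hf : Measurable f) {B r : ℝ} (hB : 0 ≤ B) (hr : 0 < r)
    (hψ1 : ∀ x, |ψ x| ≤ 1) (hψ : ∀ x y, (ψ x - ψ y) ^ 2 ≤ B * min 1 (‖x - y‖ ^ 2 / r ^ 2)) :
    energy σ E (f * ψ) ≤ 2 * energy σ E f + 2 * ENNReal.ofReal B *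
      (ENNReal.ofReal (r ^ (-(2 * σ))) * kerConst n σ) * ∫⁻ x in E, ENNReal.ofReal (f x ^ 2) := by
  simp_rw [energy_eq_lintegral_ker]
  set p := (n : ℝ) + 2 * σ
  have mf := measurable_energy_integrand hf p
  have h2 : ∫⁻ x in E, ∫⁻ y in E, 2 * ENNReal.ofReal B * ENNReal.ofReal (f x ^ 2) *
      (ENNReal.ofReal (min 1 (‖x - y‖ ^ 2 / r ^ 2)) * ker p (x - y)) ≤
      2 * ENNReal.ofReal B *
      (ENNReal.ofReal (r ^ (-(2 * σ))) * kerConst n σ) * ∫⁻ x in E, ENNReal.ofReal (f x ^ 2) := by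
    rw [← lintegral_const_mul _ (by fun_prop)]
    refine lintegral_mono fun x => ?_
    rw [lintegral_const_mul _ (by fun_prop)]
    calc _ ≤ 2 * ENNReal.ofReal B * ENNReal.ofReal (f x ^ 2) *
          (ENNReal.ofReal (r ^ (-(2 * σ))) * kerConst n σ) := by
          rw [← lintegral_min_mul_ker_sub σ hr x]
          gcongr
          exact Measure.restrict_le_self
      _ = _ := by ring
  refine le_trans ?_ (add_le_add_right h2 _)
  rw [← lintegral_lintegral_const_mul 2 mf, ← lintegral_lintegral_add (mf.const_mul 2)]
  refine lintegral_mono fun x => lintegral_mono fun y => ?_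
  simp only [Pi.mul_apply]
  have hkey : (f x * ψ x - f y * ψ y) ^ 2 ≤ 2 * (f x - f y) ^ 2 +
      2 * B * f x ^ 2 * min 1 (‖x - y‖ ^ 2 / r ^ 2) := by
    -- Discrete product rule: the first term costs the energy of `f`, and the second is integrable
    -- in `y` against the kernel, leaving the `L²` norm of `f`.
    have e : f x * ψ x - f y * ψ y = ψ y * (f x - f y) + f x * (ψ x - ψ y) := by ring
    have h1 : ψ y ^ 2 ≤ 1 := (sq_le_one_iff_abs_le_one _).2 (hψ1 y)
    have h3 : (ψ y * (f x - f y)) ^ 2 ≤ (f x - f y) ^ 2 := by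
      rw [mul_pow]; nlinarith [sq_nonneg (f x - f y)]
    have h4 : (f x * (ψ x - ψ y)) ^ 2 ≤ f x ^ 2 * (B * min 1 (‖x - y‖ ^ 2 / r ^ 2)) := by
      rw [mul_pow]; gcongr; exact hψ x y
    rw [e]
    nlinarith [sq_nonneg (ψ y * (f x - f y) - f x * (ψ x - ψ y))]
  calc _ ≤ ENNReal.ofReal (2 * (f x - f y) ^ 2 +
      2 * B * f x ^ 2 * min 1 (‖x - y‖ ^ 2 / r ^ 2)) * ker p (x - y) := by gcongr
    _ = _ := by
      rw [ENNReal.ofReal_add (by positivity) (by positivity), ENNReal.ofReal_mul (by norm_num),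
        ENNReal.ofReal_mul (by positivity), ENNReal.ofReal_mul (by positivity),
        ENNReal.ofReal_mul (by positivity), ENNReal.ofReal_ofNat]
      ring

theorem exists_sq_sub_le_of_hasCompactSupport {n : ℕ} {φ : EuclideanSpace ℝ (Fin n) → ℝ}
    (hφ : ContDiff ℝ 1 φ) (hs : HasCompactSupport φ) :
    ∃ B : ℝ, 0 ≤ B ∧ ∀ x y, (φ x - φ y) ^ 2 ≤ B * min 1 (‖x - y‖ ^ 2) := by
  obtain ⟨K, hK⟩ := hφ.lipschitzWith_of_hasCompactSupport hs one_ne_zero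
  obtain ⟨M, hM⟩ := hs.exists_bound_of_continuous hφ.continuous
  refine ⟨max (4 * M ^ 2) (K ^ 2), by positivity, fun x y => ?_⟩
  have h1 : |φ x - φ y| ≤ K * ‖x - y‖ := by
    simpa [dist_eq_norm] using hK.dist_le_mul x y
  have h2 : |φ x - φ y| ≤ 2 * M := by
    have := abs_sub (φ x) (φ y)
    have h3 := hM x
    have h4 := hM y
    rw [Real.norm_eq_abs] at h3 h4
    linarith
  rw [← sq_abs]
  rcases le_total 1 (‖x - y‖ ^ 2) with h | h
  · rw [min_eq_left h, mul_one]
    refine le_trans ?_ (le_max_left _ _)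
    calc _ ≤ (2 * M) ^ 2 := by gcongr
      _ = _ := by ring
  · rw [min_eq_right h]
    calc _ ≤ (K * ‖x - y‖) ^ 2 := by gcongr
      _ = K ^ 2 * ‖x - y‖ ^ 2 := by ring
      _ ≤ _ := by gcongr; exact le_max_right _ _

theorem energy_univ_ne_top_of_hasCompactSupport {n : ℕ} (hn : 2 ≤ n) {σ : ℝ} (hσ : 0 < σ)
    (hσ1 : σ < 1) {φ : EuclideanSpace ℝ (Fin n) → ℝ}
    (hφ : ContDiff ℝ 1 φ) (hs : HasCompactSupport φ) : energy σ univ φ ≠ ⊤ := by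
  obtain ⟨B, hB, H⟩ := exists_sq_sub_le_of_hasCompactSupport hφ hs
  have hJ := (kerConst_lt_top hn hσ hσ1).ne
  set S := tsupport φ with hS
  have hSm : MeasurableSet S := (isClosed_tsupport φ).measurableSet
  have hSv : volume S ≠ ⊤ := hs.isCompact.measure_lt_top.ne
  set p := (n : ℝ) + 2 * σ
  set s : EuclideanSpace ℝ (Fin n) → ℝ≥0∞ := S.indicator 1
  have hs1 : Measurable s := measurable_one.indicator hSm
  set g : EuclideanSpace ℝ (Fin n) → EuclideanSpace ℝ (Fin n) → ℝ≥0∞ := fun x y =>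
    ENNReal.ofReal B * s x * (ENNReal.ofReal (min 1 (‖x - y‖ ^ 2)) * ker p (x - y)) with hg
  have mg : Measurable (Function.uncurry g) := by
    simp only [hg, Function.uncurry_def]; fun_prop
  have hgi : ∫⁻ x, ∫⁻ y, g x y = ENNReal.ofReal B * volume S * kerConst n σ := by
    have : ∀ x, ∫⁻ y, g x y = (ENNReal.ofReal B * kerConst n σ) * s x := by
      intro x
      simp only [hg]
      rw [lintegral_const_mul _ (by fun_prop)]
      have := lintegral_min_mul_ker_sub σ one_pos x
      simp only [one_pow, div_one, Real.one_rpow, ENNReal.ofReal_one, one_mul] at this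
      rw [this]; ring
    simp_rw [this]
    rw [lintegral_const_mul _ hs1, lintegral_indicator_one hSm]
    ring
  have hle : energy σ univ φ ≤ ∫⁻ x, ∫⁻ y, (g x y + g y x) := by
    rw [energy_eq_lintegral_ker]
    simp only [Measure.restrict_univ]
    refine lintegral_mono fun x => lintegral_mono fun y => ?_
    simp only [hg]
    rw [ker_sub_comm p y x, norm_sub_rev y x]
    by_cases hx : x ∈ S
    · refine le_trans ?_ le_self_add
      simp only [s, hx, indicator_of_mem, Pi.one_apply, mul_one]
      rw [← mul_assoc, ← ENNReal.ofReal_mul hB]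
      gcongr
      exact H x y
    by_cases hy : y ∈ S
    · refine le_trans ?_ le_add_self
      simp only [s, hy, indicator_of_mem, Pi.one_apply, mul_one]
      rw [← mul_assoc, ← ENNReal.ofReal_mul hB]
      gcongr
      exact H x y
    · simp [image_eq_zero_of_notMem_tsupport hx, image_eq_zero_of_notMem_tsupport hy]
  refine ne_top_of_le_ne_top ?_ hle
  rw [lintegral_lintegral_add mg, ← lintegral_lintegral_swap mg.aemeasurable, hgi]
  finiteness

theorem energy_univ_le {n : ℕ} {σ : ℝ} {A : Set (EuclideanSpace ℝ (Fin n))}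
    (hA : MeasurableSet A) {w : EuclideanSpace ℝ (Fin n) → ℝ} (hwm : Measurable w)
    (hw : ∀ x ∉ A, w x = 0) :
    energy σ univ w ≤ energy σ A w + 2 * killing σ A w := by
  set p := (n : ℝ) + 2 * σ
  set a : EuclideanSpace ℝ (Fin n) → ℝ≥0∞ := A.indicator 1 with ha
  set b : EuclideanSpace ℝ (Fin n) → ℝ≥0∞ := Aᶜ.indicator 1 with hb
  have hma : Measurable a := measurable_one.indicator hA
  have hmb : Measurable b := measurable_one.indicator hA.compl
  set F : EuclideanSpace ℝ (Fin n) → EuclideanSpace ℝ (Fin n) → ℝ≥0∞ :=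
    fun x y => a x * b y * (ENNReal.ofReal (w x ^ 2) * ker p (x - y)) with hF
  set G : EuclideanSpace ℝ (Fin n) → EuclideanSpace ℝ (Fin n) → ℝ≥0∞ :=
    fun x y => a x * a y * (ENNReal.ofReal ((w x - w y) ^ 2) * ker p (x - y)) with hG
  have hXF : killing σ A w = ∫⁻ x, ∫⁻ y, F x y :=
    setLIntegral_setLIntegral_eq_indicator hA hA.compl _
  have hIG : energy σ A w = ∫⁻ x, ∫⁻ y, G x y := by
    rw [energy_eq_lintegral_ker]
    exact setLIntegral_setLIntegral_eq_indicator hA hA _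
  have hmF : Measurable (Function.uncurry F) := by
    simp only [hF, Function.uncurry_def]; fun_prop
  have hmG : Measurable (Function.uncurry G) := by
    simp only [hG, Function.uncurry_def]; fun_prop
  calc energy σ univ w ≤ ∫⁻ x, ∫⁻ y, (G x y + (F x y + F y x)) := by
        rw [energy_eq_lintegral_ker]
        simp only [Measure.restrict_univ]
        refine lintegral_mono fun x => lintegral_mono fun y => ?_
        by_cases hx : x ∈ A <;> by_cases hy : y ∈ A
        · simp [hF, hG, ha, hb, hx, hy, p]
        · simp [hF, hG, ha, hb, hx, hy, hw y hy, p]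
        · simp [hF, hG, ha, hb, hx, hy, hw x hx, p, ker_sub_comm _ x y]
        · simp [hF, hG, ha, hb, hx, hy, hw x hx, hw y hy, p]
    _ = _ := by
        rw [lintegral_lintegral_add hmG, lintegral_lintegral_add hmF,
          ← lintegral_lintegral_swap hmF.aemeasurable, ← hXF, ← hIG, two_mul]

/-! ### The space `H̊^σ(Ω)`: vanishing outside, finite full energy, multipliers. -/

theorem two_le_sobolevExponent {n : ℕ} (hn : 2 ≤ n) {σ : ℝ} (hσ : 0 < σ) (hσ1 : σ < 1) :
    2 ≤ ENNReal.ofReal (2 * (n : ℝ) / ((n : ℝ) - 2 * σ)) := by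
  have hn' : (2 : ℝ) ≤ n := by exact_mod_cast hn
  rw [← ENNReal.ofReal_ofNat 2]
  apply ENNReal.ofReal_le_ofReal
  rw [le_div_iff₀ (by linarith)]
  linarith

theorem setLIntegral_sq_le {n : ℕ} {Ω : Set (EuclideanSpace ℝ (Fin n))} {q : ℝ≥0∞} (hq : 2 ≤ q)
    {f : EuclideanSpace ℝ (Fin n) → ℝ} (hf : AEStronglyMeasurable f volume) :
    ∫⁻ x in Ω, ENNReal.ofReal (f x ^ 2) ≤
      (eLpNorm f q volume * volume Ω ^ (1 / (2 : ℝ) - 1 / q.toReal)) ^ 2 := by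
  have h1 := eLpNorm_le_eLpNorm_mul_rpow_measure_univ hq (hf.restrict (s := Ω))
  have h2 := eLpNorm_nnreal_pow_eq_lintegral (μ := volume.restrict Ω) (f := f) (p := 2) two_ne_zero
  have h3 : ∫⁻ x in Ω, ENNReal.ofReal (f x ^ 2) = eLpNorm f 2 (volume.restrict Ω) ^ 2 := by
    have e : ∀ x, ENNReal.ofReal (f x ^ 2) = ‖f x‖ₑ ^ (2 : ℝ) := by
      intro x
      rw [← sq_abs, ENNReal.ofReal_pow (abs_nonneg _), ← Real.norm_eq_abs, ofReal_norm]
      norm_cast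
    simp_rw [e]
    simpa using h2.symm
  rw [h3]
  gcongr
  refine h1.trans ?_
  simp only [Measure.restrict_apply_univ, ENNReal.toReal_ofNat]
  gcongr
  exact Measure.restrict_le_self

theorem MemHo.ae_eq_zero {n : ℕ} {σ : ℝ} (hn : 2 ≤ n) (hσ : 0 < σ) (hσ1 : σ < 1)
    {Ω : Set (EuclideanSpace ℝ (Fin n))} (hΩ : MeasurableSet Ω)
    {u : EuclideanSpace ℝ (Fin n) → ℝ} (hu : MemHo σ Ω u) : ∀ᵐ x, x ∉ Ω → u x = 0 := by
  obtain ⟨hum, φ, hφ, -, hL⟩ := hu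
  set q := ENNReal.ofReal (2 * (n : ℝ) / ((n : ℝ) - 2 * σ))
  have hq : q ≠ 0 := (two_pos.trans_le (two_le_sobolevExponent hn hσ hσ1)).ne'
  have h1 : ∀ k, eLpNorm u q (volume.restrict Ωᶜ) ≤ eLpNorm (φ k - u) q volume := by
    intro k
    refine le_trans (le_of_eq ?_) (eLpNorm_mono_measure _ (Measure.restrict_le_self (s := Ωᶜ)))
    refine eLpNorm_congr_norm_ae ?_
    filter_upwards [ae_restrict_mem hΩ.compl] with x hx
    have : φ k x = 0 := image_eq_zero_of_notMem_tsupport fun h => hx ((hφ k).2.2 h)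
    simp [this]
  have h2 : eLpNorm u q (volume.restrict Ωᶜ) = 0 :=
    le_antisymm (ge_of_tendsto' hL h1) bot_le
  rw [eLpNorm_eq_zero_iff hum.restrict hq, EventuallyEq, ae_restrict_iff' hΩ.compl] at h2
  exact h2

theorem killing_eq_lintegral_mul {n : ℕ} (σ : ℝ) (A : Set (EuclideanSpace ℝ (Fin n)))
    (w : EuclideanSpace ℝ (Fin n) → ℝ) :
    killing σ A w = ∫⁻ x in A, ENNReal.ofReal (w x ^ 2) *
      ∫⁻ y in Aᶜ, ker ((n : ℝ) + 2 * σ) (x - y) := by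
  unfold killing
  congr 1 with x
  rw [lintegral_const_mul _ (by fun_prop)]

theorem MemHo.energy_ne_top {n : ℕ} {σ : ℝ} (hn : 2 ≤ n) (hσ : 0 < σ) (hσ1 : σ < 1)
    {Ω : Set (EuclideanSpace ℝ (Fin n))}
    {u : EuclideanSpace ℝ (Fin n) → ℝ} (hum : Measurable u) (hu : MemHo σ Ω u) :
    energy σ Ω u ≠ ⊤ := by
  obtain ⟨-, φ, hφ, hE, -⟩ := hu
  obtain ⟨k, hk⟩ := (hE.eventually_lt_const zero_lt_one).exists
  have hmφ : Measurable (φ k) := (hφ k).1.continuous.measurable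
  have h1 : energy σ Ω (φ k) ≠ ⊤ := ne_top_of_le_ne_top
    (energy_univ_ne_top_of_hasCompactSupport hn hσ hσ1 (hφ k).1 (hφ k).2.1)
    (energy_mono_set (subset_univ _) _)
  have h2 := energy_sub_le (σ := σ) Ω hmφ (hmφ.sub hum)
  rw [sub_sub_cancel] at h2
  refine ne_top_of_le_ne_top ?_ h2
  have := hk.ne_top
  finiteness

/-- Membership controls only the energy inside `Ω`. Hardy's inequality applies to the test
functions, whose killing terms are finite, and Fatou along an a.e. convergent subsequence passes the
bound to `u`. This supplies the finiteness needed to absorb terms for `u` and its cutoffs. -/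
theorem MemHo.killing_ne_top {n : ℕ} {σ : ℝ} (hn : 2 ≤ n) (hσ : 1 / 2 < σ) (hσ1 : σ < 1)
    {Ω : Set (EuclideanSpace ℝ (Fin n))} (hΩ : MeasurableSet Ω)
    {u : EuclideanSpace ℝ (Fin n) → ℝ} (hum : Measurable u) (hu : MemHo σ Ω u) :
    killing σ Ω u ≠ ⊤ := by
  have hI := hu.energy_ne_top hn (by linarith) hσ1 hum
  obtain ⟨-, φ, hφ, hE, hL⟩ := hu
  obtain ⟨C, hC, H⟩ := exists_killing_le_energy n hσ
  set q := ENNReal.ofReal (2 * (n : ℝ) / ((n : ℝ) - 2 * σ))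
  have hq : q ≠ 0 :=
    (two_pos.trans_le (two_le_sobolevExponent hn (by linarith : 0 < σ) hσ1)).ne'
  have hmφ : ∀ k, Measurable (φ k) := fun k => (hφ k).1.continuous.measurable
  have hbd : ∀ᶠ k in atTop, killing σ Ω (φ k) ≤ ENNReal.ofReal C * (2 * 1 + 2 * energy σ Ω u) := by
    filter_upwards [hE.eventually_lt_const zero_lt_one] with k hk
    have hfin : killing σ Ω (φ k) ≠ ⊤ := ne_top_of_le_ne_top
      (energy_univ_ne_top_of_hasCompactSupport hn (by linarith) hσ1 (hφ k).1 (hφ k).2.1)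
      (killing_le_energy_univ hΩ fun x hx => image_eq_zero_of_notMem_tsupport
        fun h => hx ((hφ k).2.2 h))
    refine (H Ω hΩ _ (hmφ k) hfin).trans ?_
    gcongr
    have hneg : energy σ Ω (-u) = energy σ Ω u := by
      unfold energy
      congr 1 with x
      congr 1 with y
      congr 2
      simp only [Pi.neg_apply]
      ring
    have h2 := energy_sub_le (σ := σ) Ω ((hmφ k).sub hum) hum.neg
    rw [sub_neg_eq_add, sub_add_cancel, hneg] at h2
    refine h2.trans ?_
    gcongr
  have hmeas := tendstoInMeasure_of_tendsto_eLpNorm hq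
    (fun k => (hmφ k).aestronglyMeasurable) hum.aestronglyMeasurable hL
  obtain ⟨ns, hns, hae⟩ := hmeas.exists_seq_tendsto_ae
  have mW : Measurable fun x : EuclideanSpace ℝ (Fin n) =>
      ∫⁻ y in Ωᶜ, ker ((n : ℝ) + 2 * σ) (x - y) := by
    have : Measurable (Function.uncurry fun x y : EuclideanSpace ℝ (Fin n) =>
      ker ((n : ℝ) + 2 * σ) (x - y)) := by
      simp only [Function.uncurry_def]; fun_prop
    exact this.lintegral_prod_right'
  have hfatou : killing σ Ω u ≤ liminf (fun k => killing σ Ω (φ (ns k))) atTop := by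
    simp_rw [killing_eq_lintegral_mul]
    refine le_trans ?_ (lintegral_liminf_le fun k => ?_)
    · refine lintegral_mono_ae (ae_restrict_of_ae ?_)
      filter_upwards [hae] with x hx
      refine le_trans ?_ (ENNReal.le_liminf_mul)
      rw [(ENNReal.tendsto_ofReal (hx.pow 2)).liminf_eq, liminf_const]
    · have := hmφ (ns k)
      fun_prop
  refine ne_top_of_le_ne_top ?_ (hfatou.trans (liminf_le_of_frequently_le'
    (hns.tendsto_atTop.eventually hbd).frequently))
  finiteness

theorem MemHo.energy_univ_ne_top {n : ℕ} {σ : ℝ} (hn : 2 ≤ n) (hσ : 1 / 2 < σ) (hσ1 : σ < 1)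
    {Ω : Set (EuclideanSpace ℝ (Fin n))} (hΩ : MeasurableSet Ω)
    {u : EuclideanSpace ℝ (Fin n) → ℝ} (hum : Measurable u) (hu : MemHo σ Ω u)
    (h0 : ∀ x ∉ Ω, u x = 0) : energy σ univ u ≠ ⊤ := by
  refine ne_top_of_le_ne_top ?_ (energy_univ_le hΩ hum h0)
  have h1 := hu.energy_ne_top hn (by linarith) hσ1 hum
  have h2 := hu.killing_ne_top hn hσ hσ1 hΩ hum
  finiteness

/-- `H̊^σ(Ω)` is stable under multiplication by bounded Lipschitz `C¹` functions. -/
theorem MemHo.mul {n : ℕ} {σ : ℝ} (hn : 2 ≤ n) (hσ : 0 < σ) (hσ1 : σ < 1)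
    {Ω : Set (EuclideanSpace ℝ (Fin n))} (hΩ : volume Ω ≠ ⊤)
    {u ψ : EuclideanSpace ℝ (Fin n) → ℝ} (hum : Measurable u) (hu : MemHo σ Ω u)
    (hψ : ContDiff ℝ 1 ψ) {B r : ℝ} (hB : 0 ≤ B) (hr : 0 < r)
    (hψ1 : ∀ x, |ψ x| ≤ 1) (hψ2 : ∀ x y, (ψ x - ψ y) ^ 2 ≤ B * min 1 (‖x - y‖ ^ 2 / r ^ 2)) :
    MemHo σ Ω (u * ψ) := by
  obtain ⟨-, φ, hφ, hE, hL⟩ := hu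
  have hmφ : ∀ k, Measurable (φ k) := fun k => (hφ k).1.continuous.measurable
  have hJ := (kerConst_lt_top hn hσ hσ1).ne
  have hq2 := two_le_sobolevExponent hn hσ hσ1
  set q := ENNReal.ofReal (2 * (n : ℝ) / ((n : ℝ) - 2 * σ))
  refine ⟨(hum.mul hψ.continuous.measurable).aestronglyMeasurable, fun k => φ k * ψ,
    fun k => ⟨(hφ k).1.mul hψ, (hφ k).2.1.mul_right, ?_⟩, ?_, ?_⟩
  · exact (tsupport_mul_subset_left).trans (hφ k).2.2
  · simp_rw [← sub_mul]
    refine tendsto_of_tendsto_of_tendsto_of_le_of_le tendsto_const_nhds ?_ (fun _ => bot_le)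
      (fun k => (energy_mul_le (σ := σ) Ω ((hmφ k).sub hum) hB hr hψ1 hψ2).trans
        (add_le_add_right (mul_le_mul_right
          (setLIntegral_sq_le hq2 ((hmφ k).sub hum).aestronglyMeasurable) _) _))
    -- Hölder's constant. The cutoff error involves the `L²` norm on `Ω` while the approximants
    -- converge in `L^q`, hence the need for finite volume.
    set c := volume Ω ^ (1 / (2 : ℝ) - 1 / q.toReal)
    have hc : c ≠ ⊤ := by
      have h2q : 2 ≤ q.toReal := by
        simpa using ENNReal.toReal_mono ENNReal.ofReal_ne_top hq2
      refine ENNReal.rpow_ne_top_of_nonneg (sub_nonneg.2 ?_) hΩ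
      exact one_div_le_one_div_of_le two_pos h2q
    have h1 : Tendsto (fun k => 2 * energy σ Ω (φ k - u)) atTop (𝓝 (2 * 0)) :=
      ENNReal.Tendsto.const_mul hE (Or.inr (by simp))
    have h2 : Tendsto (fun k => (eLpNorm (φ k - u) q volume * c) ^ 2) atTop (𝓝 ((0 * c) ^ 2)) :=
      ((ENNReal.continuous_pow 2).tendsto _).comp (ENNReal.Tendsto.mul_const hL (Or.inr hc))
    have h3 := h1.add (ENNReal.Tendsto.const_mul (a := 2 * ENNReal.ofReal B *
      (ENNReal.ofReal (r ^ (-(2 * σ))) * kerConst n σ)) h2 (Or.inr (by finiteness)))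
    simpa using h3
  · simp_rw [← sub_mul]
    refine tendsto_of_tendsto_of_tendsto_of_le_of_le tendsto_const_nhds hL (fun _ => bot_le)
      (fun k => eLpNorm_mono fun x => ?_)
    simp only [Pi.mul_apply, norm_mul]
    exact mul_le_of_le_one_right (norm_nonneg _) (hψ1 x)

/-! ### Cutoffs and the IMS localization formula. -/

/-- Angle functions for quadratic partitions of unity adapted to concentric balls. -/
theorem exists_cutoff_angle (n : ℕ) :
    ∃ B : ℝ, 0 ≤ B ∧ ∀ (x₀ : EuclideanSpace ℝ (Fin n)) (r : ℝ), 0 < r →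
      ∃ θ : EuclideanSpace ℝ (Fin n) → ℝ, ContDiff ℝ 1 θ ∧ (∀ x, 0 ≤ θ x) ∧
        (∀ x, θ x ≤ Real.pi / 2) ∧ (∀ x ∈ Metric.ball x₀ (r / 2), θ x = Real.pi / 2) ∧
        (∀ x ∉ Metric.ball x₀ (3 / 4 * r), θ x = 0) ∧
        ∀ x y, (θ x - θ y) ^ 2 ≤ B * min 1 (‖x - y‖ ^ 2 / r ^ 2) := by
  -- One fixed bump, translated and rescaled, so that `B` depends on neither centre nor radius.
  -- Stopping at `3/4` leaves a gap before radius `r`, which the far-field kernel bound uses.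
  let χ : ContDiffBump (0 : EuclideanSpace ℝ (Fin n)) := ⟨1 / 2, 3 / 4, by norm_num, by norm_num⟩
  obtain ⟨B, hB, H⟩ := exists_sq_sub_le_of_hasCompactSupport (χ.contDiff (n := 1))
    χ.hasCompactSupport
  have hpi := Real.pi_pos
  refine ⟨(Real.pi / 2) ^ 2 * B, by positivity, fun x₀ r hr =>
    ⟨fun x => Real.pi / 2 * χ (r⁻¹ • (x - x₀)), ?_, ?_, ?_, ?_, ?_, ?_⟩⟩
  · exact contDiff_const.mul (χ.contDiff.comp (by fun_prop))
  · intro x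
    have := χ.nonneg (x := r⁻¹ • (x - x₀))
    positivity
  · intro x
    have := χ.le_one (x := r⁻¹ • (x - x₀))
    nlinarith
  · intro x hx
    simp only
    rw [χ.one_of_mem_closedBall, mul_one]
    rw [Metric.mem_ball, dist_eq_norm] at hx
    rw [mem_closedBall_zero_iff, norm_smul, norm_inv, Real.norm_of_nonneg hr.le,
      inv_mul_le_iff₀ hr]
    show _ ≤ r * (1 / 2)
    linarith
  · intro x hx
    simp only
    rw [χ.zero_of_le_dist, mul_zero]
    rw [Metric.mem_ball, dist_eq_norm, not_lt] at hx
    rw [dist_zero_right, norm_smul, norm_inv, Real.norm_of_nonneg hr.le, le_inv_mul_iff₀ hr]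
    show r * (3 / 4) ≤ _
    linarith
  · intro x y
    have h := H (r⁻¹ • (x - x₀)) (r⁻¹ • (y - x₀))
    rw [← smul_sub, sub_sub_sub_cancel_right, norm_smul, norm_inv, Real.norm_of_nonneg hr.le,
      mul_pow, inv_pow, inv_mul_eq_div] at h
    simp only
    rw [← mul_sub, mul_pow, mul_assoc]
    gcongr

theorem cos_sub_cos_sq_add_sin_sub_sin_sq (a b : ℝ) :
    (Real.cos a - Real.cos b) ^ 2 + (Real.sin a - Real.sin b) ^ 2 = 2 - 2 * Real.cos (a - b) := by
  rw [Real.cos_sub]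
  nlinarith [Real.sin_sq_add_cos_sq a, Real.sin_sq_add_cos_sq b]

theorem two_sub_two_cos_le_sq (a : ℝ) : 2 - 2 * Real.cos a ≤ a ^ 2 := by
  have := Real.one_sub_sq_div_two_le_cos (x := a)
  linarith

/-- The localization error in the IMS formula for the partition `cos² θ + sin² θ = 1`. -/
noncomputable def locError {n : ℕ} (σ : ℝ) (u θ : EuclideanSpace ℝ (Fin n) → ℝ) : ℝ≥0∞ :=
  ∫⁻ x, ∫⁻ y, ENNReal.ofReal (u x * u y * (2 - 2 * Real.cos (θ x - θ y))) *
    ker ((n : ℝ) + 2 * σ) (x - y)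

/-- Pointwise this is an identity whose error carries the product `u x * u y` rather than a square,
so the far interaction is linear in the outer values and leads to the tail of `u`. Nonnegativity of
`u` makes the error nonnegative, which permits enlarging its domain from `A` to the whole space. -/
theorem energy_cos_add_energy_sin_le {n : ℕ} {σ : ℝ} {A : Set (EuclideanSpace ℝ (Fin n))}
    {u θ : EuclideanSpace ℝ (Fin n) → ℝ} (hu : Measurable u) (hθ : Measurable θ)
    (hu0 : ∀ x, 0 ≤ u x) :
    energy σ A (u * fun x => Real.cos (θ x)) + energy σ A (u * fun x => Real.sin (θ x))
      ≤ energy σ A u + locError σ u θ := by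
  simp_rw [energy_eq_lintegral_ker, locError]
  set p := (n : ℝ) + 2 * σ
  have m1 := measurable_energy_integrand (f := u * fun x => Real.cos (θ x)) (by fun_prop) p
  have m2 := measurable_energy_integrand hu p
  rw [← lintegral_lintegral_add m1]
  have hA : ∫⁻ x in A, ∫⁻ y in A, ENNReal.ofReal (u x * u y * (2 - 2 * Real.cos (θ x - θ y))) *
      ker p (x - y) ≤ ∫⁻ x, ∫⁻ y, ENNReal.ofReal (u x * u y * (2 - 2 * Real.cos (θ x - θ y))) *
      ker p (x - y) :=
    (setLIntegral_le_lintegral _ _).trans (lintegral_mono fun x => setLIntegral_le_lintegral _ _)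
  refine le_trans ?_ (add_le_add_right hA _)
  rw [← lintegral_lintegral_add m2]
  refine lintegral_mono fun x => lintegral_mono fun y => ?_
  have hc := Real.cos_le_one (θ x - θ y)
  have h0 : 0 ≤ u x * u y * (2 - 2 * Real.cos (θ x - θ y)) :=
    mul_nonneg (mul_nonneg (hu0 x) (hu0 y)) (by linarith)
  rw [← add_mul, ← add_mul, ← ENNReal.ofReal_add (by positivity) (by positivity),
    ← ENNReal.ofReal_add (by positivity) h0]
  refine mul_le_mul_left (ENNReal.ofReal_le_ofReal ?_) _
  rw [← cos_sub_cos_sq_add_sin_sub_sin_sq]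
  simp only [Pi.mul_apply]
  apply le_of_eq
  linear_combination (u x ^ 2 - u x * u y) * Real.sin_sq_add_cos_sq (θ x) +
    (u y ^ 2 - u x * u y) * Real.sin_sq_add_cos_sq (θ y)

theorem ker_le_mul_ker {n : ℕ} {p c : ℝ} (hp : 0 ≤ p) (hc : 0 ≤ c) {z z' : EuclideanSpace ℝ (Fin n)}
    (hz' : z' ≠ 0) (h : ‖z'‖ ≤ c * ‖z‖) : ker p z ≤ ENNReal.ofReal (c ^ p) * ker p z' := by
  have h1 : 0 < ‖z'‖ := norm_pos_iff.2 hz'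
  have h2 : 0 < ‖z‖ := by
    by_contra h0
    have : ‖z‖ = 0 := le_antisymm (not_lt.1 h0) (norm_nonneg _)
    rw [this] at h
    linarith
  unfold ker
  rw [← ENNReal.ofReal_mul (by positivity)]
  apply ENNReal.ofReal_le_ofReal
  rw [← div_eq_mul_inv, le_div_iff₀ (by positivity), inv_mul_le_iff₀ (by positivity),
    ← Real.mul_rpow (by positivity) (by positivity), mul_comm]
  rw [mul_comm] at h
  gcongr
  linarith

theorem locError_integrand_le_near {n : ℕ} (p : ℝ) {u θ : EuclideanSpace ℝ (Fin n) → ℝ}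
    {B r : ℝ} (hB : 0 ≤ B) {x y : EuclideanSpace ℝ (Fin n)}
    (hθ : (θ x - θ y) ^ 2 ≤ B * min 1 (‖x - y‖ ^ 2 / r ^ 2)) :
    ENNReal.ofReal (u x * u y * (2 - 2 * Real.cos (θ x - θ y))) * ker p (x - y) ≤
      ENNReal.ofReal B * ENNReal.ofReal (u x ^ 2) *
        (ENNReal.ofReal (min 1 (‖x - y‖ ^ 2 / r ^ 2)) * ker p (x - y)) +
      ENNReal.ofReal B * ENNReal.ofReal (u y ^ 2) *
        (ENNReal.ofReal (min 1 (‖x - y‖ ^ 2 / r ^ 2)) * ker p (x - y)) := by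
  have h1 : u x * u y ≤ u x ^ 2 + u y ^ 2 := by
    nlinarith [sq_nonneg (u x - u y), sq_nonneg (u x), sq_nonneg (u y)]
  have h2 := (two_sub_two_cos_le_sq (θ x - θ y)).trans hθ
  have h3 : u x * u y * (2 - 2 * Real.cos (θ x - θ y)) ≤
      B * (u x ^ 2 + u y ^ 2) * min 1 (‖x - y‖ ^ 2 / r ^ 2) := by
    calc _ ≤ (u x ^ 2 + u y ^ 2) * (B * min 1 (‖x - y‖ ^ 2 / r ^ 2)) :=
          mul_le_mul h1 h2 (by linarith [Real.cos_le_one (θ x - θ y)]) (by positivity)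
      _ = _ := by ring
  calc _ ≤ ENNReal.ofReal (B * (u x ^ 2 + u y ^ 2) * min 1 (‖x - y‖ ^ 2 / r ^ 2)) *
        ker p (x - y) := by gcongr
    _ = _ := by
      rw [ENNReal.ofReal_mul (by positivity), ENNReal.ofReal_mul hB,
        ENNReal.ofReal_add (by positivity) (by positivity)]
      ring

theorem locError_integrand_le_far {n : ℕ} {p : ℝ} (hp : 0 ≤ p)
    {u θ : EuclideanSpace ℝ (Fin n) → ℝ} (hu0 : ∀ x, 0 ≤ u x)
    {x₀ : EuclideanSpace ℝ (Fin n)} {r : ℝ} (hr : 0 < r)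
    (hθ0 : ∀ x ∉ Metric.ball x₀ (3 / 4 * r), θ x = 0) {x y : EuclideanSpace ℝ (Fin n)}
    (hy : y ∉ Metric.ball x₀ r) :
    ENNReal.ofReal (u x * u y * (2 - 2 * Real.cos (θ x - θ y))) * ker p (x - y) ≤
      ENNReal.ofReal (4 * 4 ^ p) * ENNReal.ofReal (u x) *
        (ENNReal.ofReal (u y) * ker p (y - x₀)) := by
  have hy0 : θ y = 0 := hθ0 y fun hy' => hy (Metric.ball_subset_ball (by linarith) hy')
  by_cases hx' : x ∈ Metric.ball x₀ (3 / 4 * r)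
  swap
  · simp [hθ0 x hx', hy0]
  have hk : ker p (x - y) ≤ ENNReal.ofReal (4 ^ p) * ker p (y - x₀) := by
    rw [Metric.mem_ball, not_lt, dist_eq_norm] at hy
    rw [Metric.mem_ball, dist_eq_norm] at hx'
    refine ker_le_mul_ker hp (by norm_num) (norm_pos_iff.1 (hr.trans_le hy)) ?_
    -- Since `‖x - x₀‖ < (3/4) r ≤ (3/4) ‖y - x₀‖`, at least a quarter of `‖y - x₀‖` remains for `‖x
    -- - y‖`; hence the constant `4`.
    have : ‖y - x₀‖ ≤ ‖x - y‖ + ‖x - x₀‖ := by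
      rw [norm_sub_rev x y]; exact norm_sub_le_norm_sub_add_norm_sub _ _ _
    linarith
  have h4 : u x * u y * (2 - 2 * Real.cos (θ x - θ y)) ≤ u x * u y * 4 :=
    mul_le_mul_of_nonneg_left (by linarith [Real.neg_one_le_cos (θ x - θ y)])
      (mul_nonneg (hu0 x) (hu0 y))
  calc _ ≤ ENNReal.ofReal (u x * u y * 4) * (ENNReal.ofReal (4 ^ p) * ker p (y - x₀)) :=
        mul_le_mul' (ENNReal.ofReal_le_ofReal h4) hk
    _ = _ := by
        rw [ENNReal.ofReal_mul (mul_nonneg (hu0 x) (hu0 y)), ENNReal.ofReal_mul (hu0 x),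
          ENNReal.ofReal_mul (by norm_num : (0:ℝ) ≤ 4)]
        ring

/-- Pairs inside the ball use the Lipschitz bound on `θ` and give the `L²` term. Mixed pairs use the
far-field bound and factor as mass times tail. Pairs outside contribute nothing. -/
theorem locError_le {n : ℕ} {σ : ℝ} (hσ : 0 < σ) {u θ : EuclideanSpace ℝ (Fin n) → ℝ}
    (hu : Measurable u) (hu0 : ∀ x, 0 ≤ u x)
    {x₀ : EuclideanSpace ℝ (Fin n)} {B r : ℝ} (hB : 0 ≤ B) (hr : 0 < r)
    (hθ0 : ∀ x ∉ Metric.ball x₀ (3 / 4 * r), θ x = 0)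
    (hθ : ∀ x y, (θ x - θ y) ^ 2 ≤ B * min 1 (‖x - y‖ ^ 2 / r ^ 2)) :
    locError σ u θ ≤
      2 * (ENNReal.ofReal B * (ENNReal.ofReal (r ^ (-(2 * σ))) * kerConst n σ) *
        ∫⁻ x in Metric.ball x₀ r, ENNReal.ofReal (u x ^ 2)) +
      2 * (ENNReal.ofReal (4 * 4 ^ ((n : ℝ) + 2 * σ)) *
        ((∫⁻ x in Metric.ball x₀ r, ENNReal.ofReal (u x)) *
        ∫⁻ y in (Metric.ball x₀ r)ᶜ, ENNReal.ofReal (u y) * ker ((n : ℝ) + 2 * σ) (y - x₀))) := by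
  set p := (n : ℝ) + 2 * σ with hp
  have hp0 : 0 ≤ p := by positivity
  set D := Metric.ball x₀ r with hD
  have hDm : MeasurableSet D := measurableSet_ball
  set a : EuclideanSpace ℝ (Fin n) → ℝ≥0∞ := D.indicator 1 with ha
  set b : EuclideanSpace ℝ (Fin n) → ℝ≥0∞ := Dᶜ.indicator 1 with hb
  have hma : Measurable a := measurable_one.indicator hDm
  have hmb : Measurable b := measurable_one.indicator hDm.compl
  set g : EuclideanSpace ℝ (Fin n) → EuclideanSpace ℝ (Fin n) → ℝ≥0∞ := fun x y =>
    ENNReal.ofReal B * (a x * ENNReal.ofReal (u x ^ 2)) *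
      (ENNReal.ofReal (min 1 (‖x - y‖ ^ 2 / r ^ 2)) * ker p (x - y)) with hg
  set h : EuclideanSpace ℝ (Fin n) → EuclideanSpace ℝ (Fin n) → ℝ≥0∞ := fun x y =>
    ENNReal.ofReal (4 * 4 ^ p) * (a x * ENNReal.ofReal (u x)) *
      (b y * (ENNReal.ofReal (u y) * ker p (y - x₀))) with hh
  have mg : Measurable (Function.uncurry g) := by
    simp only [hg, Function.uncurry_def]; fun_prop
  have mh : Measurable (Function.uncurry h) := by
    simp only [hh, Function.uncurry_def]; fun_prop
  have mg' : Measurable (Function.uncurry fun x y => g y x) := by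
    simp only [hg, Function.uncurry_def]; fun_prop
  have ind : ∀ (S : Set (EuclideanSpace ℝ (Fin n))), MeasurableSet S →
      ∀ f : EuclideanSpace ℝ (Fin n) → ℝ≥0∞,
      ∫⁻ x, S.indicator 1 x * f x = ∫⁻ x in S, f x := by
    intro S hS f
    rw [← lintegral_indicator hS]
    congr 1 with x
    by_cases hx : x ∈ S <;> simp [hx]
  have hgi : ∫⁻ x, ∫⁻ y, g x y = ENNReal.ofReal B *
      (ENNReal.ofReal (r ^ (-(2 * σ))) * kerConst n σ) * ∫⁻ x in D, ENNReal.ofReal (u x ^ 2) := by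
    rw [← ind D hDm, ← lintegral_const_mul _ (by fun_prop)]
    congr 1 with x
    simp only [hg]
    rw [lintegral_const_mul _ (by fun_prop), lintegral_min_mul_ker_sub σ hr x]
    ring
  have hhi : ∫⁻ x, ∫⁻ y, h x y = ENNReal.ofReal (4 * 4 ^ p) *
      ((∫⁻ x in D, ENNReal.ofReal (u x)) * ∫⁻ y in Dᶜ, ENNReal.ofReal (u y) * ker p (y - x₀)) := by
    rw [← ind D hDm, ← ind Dᶜ hDm.compl, ← lintegral_mul_const _ (by fun_prop),
      ← lintegral_const_mul _ (by fun_prop)]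
    congr 1 with x
    simp only [hh]
    rw [lintegral_const_mul _ (by fun_prop), mul_assoc]
  have hfar : ∀ x ∈ D, ∀ y ∉ D, ENNReal.ofReal (u x * u y * (2 - 2 * Real.cos (θ x - θ y))) *
      ker p (x - y) ≤ h x y := by
    intro x hx y hy
    simp only [hh, ha, hb, hx, hy, indicator_of_mem, mem_compl_iff, not_false_eq_true,
      Pi.one_apply, one_mul]
    exact locError_integrand_le_far hp0 hu0 hr hθ0 hy
  have hpt : ∀ x y, ENNReal.ofReal (u x * u y * (2 - 2 * Real.cos (θ x - θ y))) * ker p (x - y) ≤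
      (g x y + g y x) + (h x y + h y x) := by
    intro x y
    by_cases hx : x ∈ D <;> by_cases hy : y ∈ D
    · refine le_trans ?_ le_self_add
      simp only [hg, ha, hx, hy, indicator_of_mem, Pi.one_apply, one_mul]
      rw [ker_sub_comm p y x, norm_sub_rev y x]
      exact locError_integrand_le_near p hB (hθ x y)
    · exact (hfar x hx y hy).trans (le_self_add.trans le_add_self)
    · rw [mul_comm (u x), ← Real.cos_neg, neg_sub, ker_sub_comm p x y]
      exact (hfar y hy x hx).trans (le_add_self.trans le_add_self)
    · have hsub : Metric.ball x₀ (3 / 4 * r) ⊆ D := Metric.ball_subset_ball (by linarith)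
      simp [hθ0 x fun h => hx (hsub h), hθ0 y fun h => hy (hsub h)]
  calc locError σ u θ ≤ ∫⁻ x, ∫⁻ y, ((g x y + g y x) + (h x y + h y x)) :=
        lintegral_mono fun x => lintegral_mono fun y => hpt x y
    _ = _ := by
        rw [lintegral_lintegral_add (f := fun x y => g x y + g y x) (mg.add mg'),
          lintegral_lintegral_add mg, lintegral_lintegral_add mh,
          ← lintegral_lintegral_swap mg.aemeasurable, ← lintegral_lintegral_swap mh.aemeasurable,
          hgi, hhi, ← two_mul, ← two_mul]

/-! ### Consequences of minimality. -/

/-- As `S ≥ 1 - U` with `U ≤ 1/2`, one has `1/S ≤ 1 + 2U`. Renormalizing the competitor thus costs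
at most `2 U * IV ≤ 2 U (C₀ + Er)`, and `2 U * Er ≤ Er`. -/
theorem ennreal_minimality_gain {IA IV IW Er U S mA mV mB C₀ : ℝ≥0∞} (hC₀ : C₀ ≠ ⊤)
    (hIA : IA ≤ C₀) (hmA : mA ≠ ⊤) (h1 : IV + IW ≤ IA + Er) (h2 : 1 ≤ S + U) (hU : U ≤ 1 / 2)
    (hS : S ≤ 1) (h3 : mV + mB ≤ mA) (hmin : IA + mA ≤ IV / S + mV) :
    mB + IW ≤ 2 * Er + 2 * C₀ * U := by
  rcases eq_or_ne Er ⊤ with rfl | hEr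
  · simp
  have hIA' : IA ≠ ⊤ := ne_top_of_le_ne_top hC₀ hIA
  have hsum : IV + IW ≠ ⊤ := ne_top_of_le_ne_top (by finiteness) h1
  have hsum2 : mV + mB ≠ ⊤ := ne_top_of_le_ne_top hmA h3
  rw [ENNReal.add_ne_top] at hsum hsum2
  obtain ⟨hIV, hIW⟩ := hsum
  obtain ⟨hmV, hmB⟩ := hsum2
  have hU' : U ≠ ⊤ := ne_top_of_le_ne_top (by finiteness) hU
  have hS' : S ≠ ⊤ := ne_top_of_le_ne_top (by finiteness) hS
  lift IA to NNReal using hIA'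
  lift IV to NNReal using hIV
  lift IW to NNReal using hIW
  lift Er to NNReal using hEr
  lift U to NNReal using hU'
  lift S to NNReal using hS'
  lift mA to NNReal using hmA
  lift mV to NNReal using hmV
  lift mB to NNReal using hmB
  lift C₀ to NNReal using hC₀
  have hU2 : (U : ℝ) ≤ 1 / 2 := by
    have := ENNReal.toReal_mono (by finiteness) hU
    simpa using this
  have h2' : (1 : ℝ) ≤ S + U := by exact_mod_cast h2
  have hSpos : (0 : ℝ) < S := by linarith
  have hS0 : S ≠ 0 := by
    rintro rfl
    simp at hSpos
  rw [← ENNReal.coe_div hS0] at hmin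
  have g1 : (IV : ℝ) + IW ≤ IA + Er := by exact_mod_cast h1
  have g3 : (mV : ℝ) + mB ≤ mA := by exact_mod_cast h3
  have g4 : (IA : ℝ) + mA ≤ IV / S + mV := by exact_mod_cast hmin
  have g5 : (IA : ℝ) ≤ C₀ := by exact_mod_cast hIA
  have g6 : (IV : ℝ) / S ≤ IV * (1 + 2 * U) := by
    rw [div_le_iff₀ hSpos, mul_assoc]
    refine le_mul_of_one_le_right IV.2 ?_
    nlinarith [U.2]
  have g7 : (U : ℝ) * IV ≤ U * (C₀ + Er) := by
    gcongr
    have := IW.2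
    simp only [NNReal.val_eq_coe] at this
    linarith
  have g8 : (U : ℝ) * Er ≤ 1 / 2 * Er := by gcongr
  have : (mB : ℝ) + IW ≤ 2 * Er + 2 * C₀ * U := by nlinarith
  exact_mod_cast this

/-- A measurable, everywhere nonnegative representative, vanishing off `B_N`, of an
`L²`-normalized minimizer of `m(N)`. -/
structure IsNormalizedMinimizer {n : ℕ} (σ N : ℝ) (u : EuclideanSpace ℝ (Fin n) → ℝ) : Prop where
  measurable : Measurable u
  nonneg : ∀ x, 0 ≤ u x
  eq_zero : ∀ x ∉ Metric.ball (0 : EuclideanSpace ℝ (Fin n)) N, u x = 0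
  memHo : MemHo σ (Metric.ball 0 N) u
  lintegral_sq : ∫⁻ x, ENNReal.ofReal (u x ^ 2) = 1
  add_le : energy σ {x | 0 < u x} u + volume {x | 0 < u x} ≤ m n σ N

namespace IsNormalizedMinimizer

variable {n : ℕ} {σ N : ℝ} {u : EuclideanSpace ℝ (Fin n) → ℝ}

theorem measurableSet_pos (hu : IsNormalizedMinimizer σ N u) : MeasurableSet {x | 0 < u x} :=
  measurableSet_lt measurable_const hu.measurable

theorem pos_subset (hu : IsNormalizedMinimizer σ N u) : {x | 0 < u x} ⊆ Metric.ball 0 N := by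
  intro x hx
  by_contra h
  rw [mem_ofPred_eq, hu.eq_zero x h] at hx
  exact lt_irrefl _ hx

theorem volume_pos_ne_top (hu : IsNormalizedMinimizer σ N u) : volume {x | 0 < u x} ≠ ⊤ :=
  ne_top_of_le_ne_top measure_ball_lt_top.ne (measure_mono hu.pos_subset)

theorem setLIntegral_sq (hu : IsNormalizedMinimizer σ N u) :
    ∫⁻ x in Metric.ball 0 N, ENNReal.ofReal (u x ^ 2) = 1 := by
  rw [← hu.lintegral_sq]
  refine setLIntegral_eq_of_support_subset fun x hx => ?_
  by_contra h
  simp [hu.eq_zero x h] at hx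

theorem energy_univ_ne_top (hu : IsNormalizedMinimizer σ N u) (hn : 2 ≤ n) (hσ : 1 / 2 < σ)
    (hσ1 : σ < 1) : energy σ univ u ≠ ⊤ :=
  hu.memHo.energy_univ_ne_top hn hσ hσ1 measurableSet_ball hu.measurable hu.eq_zero

/-- Testing minimality with `u cos θ`: the measure of `{u > 0}` in the half ball is saved and the
energy of `u sin θ` is split off, so both are paid for by the localization error and the lost mass.
-/
theorem gain (hu : IsNormalizedMinimizer σ N u) (hn : 2 ≤ n) (hσ : 1 / 2 < σ) (hσ1 : σ < 1)
    {C₀ : ℝ≥0∞} (hC₀ : C₀ ≠ ⊤) (hm : m n σ N ≤ C₀)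
    {x₀ : EuclideanSpace ℝ (Fin n)} {B r : ℝ} (hB : 0 ≤ B) (hr : 0 < r)
    {θ : EuclideanSpace ℝ (Fin n) → ℝ} (hθc : ContDiff ℝ 1 θ)
    (hθn : ∀ x, 0 ≤ θ x) (hθp : ∀ x, θ x ≤ Real.pi / 2)
    (hθ1 : ∀ x ∈ Metric.ball x₀ (r / 2), θ x = Real.pi / 2)
    (hθ0 : ∀ x ∉ Metric.ball x₀ (3 / 4 * r), θ x = 0)
    (hθ : ∀ x y, (θ x - θ y) ^ 2 ≤ B * min 1 (‖x - y‖ ^ 2 / r ^ 2))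
    (hU : ∫⁻ x in Metric.ball x₀ r, ENNReal.ofReal (u x ^ 2) ≤ 1 / 2) :
    volume ({x | 0 < u x} ∩ Metric.ball x₀ (r / 2)) +
      energy σ {x | 0 < u x} (u * fun x => Real.sin (θ x)) ≤
      2 * locError σ u θ +
        2 * C₀ * ∫⁻ x in Metric.ball x₀ r, ENNReal.ofReal (u x ^ 2) := by
  set ψ : EuclideanSpace ℝ (Fin n) → ℝ := fun x => Real.cos (θ x) with hψ
  set v := u * ψ with hv
  have hmu := hu.measurable
  have hmθ : Measurable θ := hθc.continuous.measurable
  have hψ0 : ∀ x, 0 ≤ ψ x := fun x =>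
    Real.cos_nonneg_of_mem_Icc ⟨by linarith [hθn x, Real.pi_pos], hθp x⟩
  have hψ2 : ∀ x y, (ψ x - ψ y) ^ 2 ≤ B * min 1 (‖x - y‖ ^ 2 / r ^ 2) := by
    intro x y
    refine le_trans ?_ (hθ x y)
    have h1 := cos_sub_cos_sq_add_sin_sub_sin_sq (θ x) (θ y)
    have h2 := two_sub_two_cos_le_sq (θ x - θ y)
    have h3 := sq_nonneg (Real.sin (θ x) - Real.sin (θ y))
    simp only [hψ]
    linarith
  have hmem : MemHo σ (Metric.ball 0 N) v :=
    hu.memHo.mul hn (by linarith) hσ1 measure_ball_lt_top.ne hmu (Real.contDiff_cos.comp hθc)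
      hB hr (fun x => Real.abs_cos_le_one _) hψ2
  have hv0 : ∀ x, 0 ≤ v x := fun x => mul_nonneg (hu.nonneg x) (hψ0 x)
  set S := ∫⁻ x in Metric.ball 0 N, ENNReal.ofReal (v x ^ 2) with hS
  set U := ∫⁻ x in Metric.ball x₀ r, ENNReal.ofReal (u x ^ 2) with hUdef
  have hmv : Measurable v := hmu.mul (Real.measurable_cos.comp hmθ)
  have hSU : 1 ≤ S + U := by
    have e1 : ∫⁻ x in Metric.ball 0 N, ENNReal.ofReal ((u x * Real.sin (θ x)) ^ 2) ≤ U := by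
      refine (setLIntegral_le_lintegral _ _).trans ?_
      rw [hUdef, ← lintegral_indicator measurableSet_ball]
      refine lintegral_mono fun x => ?_
      by_cases hx : x ∈ Metric.ball x₀ r
      · rw [indicator_of_mem hx]
        apply ENNReal.ofReal_le_ofReal
        rw [mul_pow]
        exact mul_le_of_le_one_right (sq_nonneg _) (Real.sin_sq_le_one _)
      · rw [hθ0 x fun h => hx (Metric.ball_subset_ball (by linarith) h)]
        simp
    rw [← hu.setLIntegral_sq]
    refine le_trans (le_of_eq ?_) (add_le_add_right e1 S)
    rw [hS, ← lintegral_add_left (by fun_prop)]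
    congr 1 with x
    rw [← ENNReal.ofReal_add (by positivity) (by positivity)]
    congr 1
    simp only [hv, hψ, Pi.mul_apply]
    linear_combination -u x ^ 2 * Real.sin_sq_add_cos_sq (θ x)
  have hS1 : S ≤ 1 := by
    rw [← hu.setLIntegral_sq]
    refine lintegral_mono fun x => ENNReal.ofReal_le_ofReal ?_
    simp only [hv, Pi.mul_apply, mul_pow]
    exact mul_le_of_le_one_right (sq_nonneg _) (Real.cos_sq_le_one _)
  have hSpos : S ≠ 0 := by
    intro h
    rw [h, zero_add] at hSU
    have := hSU.trans hU
    norm_num at this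
  have hadm : Admissible σ N v := by
    refine ⟨hmem, fun h => hSpos ?_, Eventually.of_forall hv0⟩
    rw [hS, lintegral_eq_zero_iff (by fun_prop)]
    filter_upwards [ae_restrict_of_ae h] with x hx
    simp [hx]
  have hle : m n σ N ≤ functional σ N v := sInf_le ⟨v, hadm, rfl⟩
  have hsub : {x | 0 < v x} ⊆ {x | 0 < u x} \ Metric.ball x₀ (r / 2) := by
    intro x hx
    refine ⟨?_, fun h => ?_⟩
    · refine (hu.nonneg x).lt_of_ne fun h => ?_
      simp [hv, ← h] at hx
    · simp [hv, hψ, hθ1 x h] at hx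
  refine ennreal_minimality_gain (IA := energy σ {x | 0 < u x} u)
    (IV := energy σ {x | 0 < u x} v) (S := S) (mA := volume {x | 0 < u x})
    (mV := volume {x | 0 < v x}) hC₀ (le_self_add.trans (hu.add_le.trans hm)) hu.volume_pos_ne_top
    (energy_cos_add_energy_sin_le hmu hmθ hu.nonneg) hSU hU hS1 ?_ ?_
  · rw [← measure_sdiff_add_inter {x | 0 < u x} (measurableSet_ball (x := x₀) (ε := r / 2))]
    gcongr
  · refine (hu.add_le.trans hle).trans ?_
    unfold functional
    gcongr
    exact energy_mono_set (hsub.trans sdiff_subset) _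

/-- One step of the density iteration. -/
theorem exists_step (n : ℕ) (hn : 2 ≤ n) {σ : ℝ} (hσ : 1 / 2 < σ) (hσ1 : σ < 1)
    {C₀ : ℝ≥0∞} (hC₀ : C₀ ≠ ⊤) :
    ∃ C : ℝ, 0 < C ∧ ∀ (N : ℝ) (u : EuclideanSpace ℝ (Fin n) → ℝ), IsNormalizedMinimizer σ N u →
      m n σ N ≤ C₀ → ∀ (x₀ : EuclideanSpace ℝ (Fin n)) (r : ℝ), 0 < r → r ≤ 1 →
      ∫⁻ x in Metric.ball x₀ r, ENNReal.ofReal (u x ^ 2) ≤ 1 / 2 →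
      ∀ E : ℝ≥0∞, ENNReal.ofReal (r ^ (-(2 * σ))) *
          (∫⁻ x in Metric.ball x₀ r, ENNReal.ofReal (u x ^ 2)) +
        (∫⁻ x in Metric.ball x₀ r, ENNReal.ofReal (u x)) *
        (∫⁻ y in (Metric.ball x₀ r)ᶜ, ENNReal.ofReal (u y) * ker ((n : ℝ) + 2 * σ) (y - x₀)) ≤ E →
      volume ({x | 0 < u x} ∩ Metric.ball x₀ (r / 2)) ≤ ENNReal.ofReal C * E ∧
      ∀ κ : ℝ, 0 < κ → volume ({x | 0 < u x} ∩ Metric.ball x₀ r) ≤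
          ENNReal.ofReal ((κ * r) ^ n * unitVol n / 2) →
        ∫⁻ x in Metric.ball x₀ (r / 2), ENNReal.ofReal (u x ^ 2) ≤
          ENNReal.ofReal (C * (κ * r) ^ (2 * σ)) * E := by
  obtain ⟨B, hB, hcut⟩ := exists_cutoff_angle n
  obtain ⟨F, hF, hFK⟩ := exists_lintegral_sq_le_energy n hσ
  have hJ := (kerConst_lt_top hn (by linarith : 0 < σ) hσ1).ne
  set K₁ : ℝ≥0∞ := 4 * (ENNReal.ofReal B * kerConst n σ) + 2 * C₀ with hK₁
  set K₂ : ℝ≥0∞ := 4 * ENNReal.ofReal (4 * 4 ^ ((n : ℝ) + 2 * σ)) with hK₂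
  have hK : K₁ + K₂ ≠ ⊤ := by finiteness
  set C₁ : ℝ := (K₁ + K₂).toReal with hC₁
  -- One constant for both conclusions, independent of `κ`: the iteration later picks `κ` in terms
  -- of it.
  refine ⟨(C₁ + 1) * (F + 1), by positivity, ?_⟩
  intro N u hu hm x₀ r hr hr1 hU E hE
  obtain ⟨θ, hθc, hθn, hθp, hθ1, hθ0, hθ⟩ := hcut x₀ r hr
  have hg := hu.gain hn hσ hσ1 hC₀ hm hB hr hθc hθn hθp hθ1 hθ0 hθ hU
  have hloc := locError_le (by linarith : 0 < σ) hu.measurable hu.nonneg hB hr hθ0 hθ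
  set U := ∫⁻ x in Metric.ball x₀ r, ENNReal.ofReal (u x ^ 2) with hUdef
  set V := ∫⁻ x in Metric.ball x₀ r, ENNReal.ofReal (u x)
  set T := ∫⁻ y in (Metric.ball x₀ r)ᶜ, ENNReal.ofReal (u y) * ker ((n : ℝ) + 2 * σ) (y - x₀)
  set R := ENNReal.ofReal (r ^ (-(2 * σ))) with hR
  -- Because `r ≤ 1`, the lower-order term `2 C₀ U` is absorbed into `r^(-2σ) U`.
  have hR1 : 1 ≤ R := by
    rw [hR, ENNReal.one_le_ofReal]
    exact Real.one_le_rpow_of_pos_of_le_one_of_nonpos hr hr1 (by linarith)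
  have hmain : volume ({x | 0 < u x} ∩ Metric.ball x₀ (r / 2)) +
      energy σ {x | 0 < u x} (u * fun x => Real.sin (θ x)) ≤ ENNReal.ofReal (C₁ + 1) * E := by
    calc _ ≤ _ := hg
      _ ≤ 2 * (2 * (ENNReal.ofReal B * (R * kerConst n σ) * U) +
          2 * (ENNReal.ofReal (4 * 4 ^ ((n : ℝ) + 2 * σ)) * (V * T))) + 2 * C₀ * (R * U) := by
          gcongr
          exact le_mul_of_one_le_left bot_le hR1
      _ = K₁ * (R * U) + K₂ * (V * T) := by rw [hK₁, hK₂]; ring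
      _ ≤ (K₁ + K₂) * (R * U) + (K₁ + K₂) * (V * T) := by
          gcongr
          · exact le_self_add
          · exact le_add_self
      _ = (K₁ + K₂) * (R * U + V * T) := by ring
      _ ≤ ENNReal.ofReal (C₁ + 1) * E := by
          gcongr
          rw [← ENNReal.ofReal_toReal hK]
          exact ENNReal.ofReal_le_ofReal (by linarith)
  have hC₁0 : 0 ≤ C₁ := ENNReal.toReal_nonneg
  refine ⟨(le_self_add.trans hmain).trans ?_, fun κ hκ hvol => ?_⟩
  · gcongr
    nlinarith
  set w : EuclideanSpace ℝ (Fin n) → ℝ := u * fun x => Real.sin (θ x) with hw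
  have hmθ : Measurable θ := hθc.continuous.measurable
  have hmw : Measurable w := hu.measurable.mul (Real.measurable_sin.comp hmθ)
  have hwE : energy σ univ w ≠ ⊤ := by
    have h1 := hu.energy_univ_ne_top hn hσ hσ1
    refine ne_top_of_le_ne_top ?_ (energy_mul_le (σ := σ) univ hu.measurable hB hr
      (fun x => Real.abs_sin_le_one _) fun x y => ?_)
    · rw [Measure.restrict_univ, hu.lintegral_sq]
      finiteness
    · refine le_trans ?_ (hθ x y)
      have h1 := cos_sub_cos_sq_add_sin_sub_sin_sq (θ x) (θ y)
      have h2 := two_sub_two_cos_le_sq (θ x - θ y)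
      have h3 := sq_nonneg (Real.cos (θ x) - Real.cos (θ y))
      linarith
  have hw0 : ∀ x ∉ {x | 0 < u x} ∩ Metric.ball x₀ r, w x = 0 := by
    intro x hx
    by_cases hxu : 0 < u x
    · have hxr : x ∉ Metric.ball x₀ r := fun h => hx ⟨hxu, h⟩
      simp [hw, hθ0 x fun h => hxr (Metric.ball_subset_ball (by linarith) h)]
    · simp [hw, le_antisymm (not_lt.1 hxu) (hu.nonneg x)]
  have hfk := hFK _ (hu.measurableSet_pos.inter measurableSet_ball) w hmw hwE hw0 (κ * r)
    (by positivity) hvol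
  calc ∫⁻ x in Metric.ball x₀ (r / 2), ENNReal.ofReal (u x ^ 2)
      = ∫⁻ x in Metric.ball x₀ (r / 2), ENNReal.ofReal (w x ^ 2) := by
        refine setLIntegral_congr_fun measurableSet_ball fun x hx => ?_
        simp [hw, hθ1 x hx]
    _ ≤ ∫⁻ x, ENNReal.ofReal (w x ^ 2) := setLIntegral_le_lintegral _ _
    _ ≤ _ := hfk
    _ ≤ ENNReal.ofReal (F * (κ * r) ^ (2 * σ)) * (ENNReal.ofReal (C₁ + 1) * E) := by
        gcongr
        exact (energy_mono_set inter_subset_left _).trans (le_add_self.trans hmain)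
    _ ≤ _ := by
        rw [← mul_assoc, ← ENNReal.ofReal_mul (by positivity)]
        refine mul_le_mul_left (ENNReal.ofReal_le_ofReal ?_) _
        have : 0 ≤ (κ * r) ^ (2 * σ) := by positivity
        nlinarith [mul_nonneg this hC₁0]

end IsNormalizedMinimizer

/-! ### The density iteration. -/

/-- Young's inequality `u ≤ (s u² + 1/s)/2` on `{u > 0}`; the free weight `s` replaces the square
root of Cauchy–Schwarz. -/
theorem setLIntegral_le_of_sq_le {n : ℕ} {u : EuclideanSpace ℝ (Fin n) → ℝ} (hu : Measurable u)
    {D : Set (EuclideanSpace ℝ (Fin n))} {a b s : ℝ} (ha : 0 ≤ a) (hb : 0 ≤ b) (hs : 0 < s)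
    (hU : ∫⁻ x in D, ENNReal.ofReal (u x ^ 2) ≤ ENNReal.ofReal a)
    (hA : volume ({x | 0 < u x} ∩ D) ≤ ENNReal.ofReal b) :
    ∫⁻ x in D, ENNReal.ofReal (u x) ≤ ENNReal.ofReal ((s * a + b / s) / 2) := by
  have hP : MeasurableSet {x | 0 < u x} := measurableSet_lt measurable_const hu
  calc ∫⁻ x in D, ENNReal.ofReal (u x)
      ≤ ∫⁻ x in D, (ENNReal.ofReal (s / 2) * ENNReal.ofReal (u x ^ 2) +
        {x | 0 < u x}.indicator (fun _ => ENNReal.ofReal (1 / (2 * s))) x) := by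
        refine lintegral_mono fun x => ?_
        by_cases hx : 0 < u x
        · rw [indicator_of_mem (show x ∈ {x | 0 < u x} from hx),
            ← ENNReal.ofReal_mul (by positivity),
            ← ENNReal.ofReal_add (by positivity) (by positivity)]
          apply ENNReal.ofReal_le_ofReal
          have h1 : s / 2 * u x ^ 2 + 1 / (2 * s) - u x = (s * u x - 1) ^ 2 / (2 * s) := by
            field_simp; ring
          have h2 : 0 ≤ (s * u x - 1) ^ 2 / (2 * s) := by positivity
          linarith
        · rw [ENNReal.ofReal_of_nonpos (not_lt.1 hx)]
          exact bot_le
    _ = ENNReal.ofReal (s / 2) * (∫⁻ x in D, ENNReal.ofReal (u x ^ 2)) +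
        ENNReal.ofReal (1 / (2 * s)) * volume ({x | 0 < u x} ∩ D) := by
        rw [lintegral_add_left (by fun_prop), lintegral_const_mul _ (by fun_prop),
          lintegral_indicator_const hP, Measure.restrict_apply hP]
    _ ≤ ENNReal.ofReal (s / 2) * ENNReal.ofReal a +
        ENNReal.ofReal (1 / (2 * s)) * ENNReal.ofReal b := by gcongr
    _ = _ := by
        rw [← ENNReal.ofReal_mul (by positivity), ← ENNReal.ofReal_mul (by positivity),
          ← ENNReal.ofReal_add (by positivity) (by positivity)]
        congr 1
        field_simp

theorem tail_half_le {n : ℕ} {p : ℝ} (hp : 0 ≤ p) {u : EuclideanSpace ℝ (Fin n) → ℝ}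
    {x₀ : EuclideanSpace ℝ (Fin n)} {r : ℝ} (hr : 0 < r) :
    ∫⁻ y in (Metric.ball x₀ (r / 2))ᶜ, ENNReal.ofReal (u y) * ker p (y - x₀) ≤
      (∫⁻ y in (Metric.ball x₀ r)ᶜ, ENNReal.ofReal (u y) * ker p (y - x₀)) +
      ENNReal.ofReal ((r / 2) ^ (-p)) * ∫⁻ y in Metric.ball x₀ r, ENNReal.ofReal (u y) := by
  have hsub : (Metric.ball x₀ (r / 2))ᶜ ⊆
      (Metric.ball x₀ r)ᶜ ∪ (Metric.ball x₀ r \ Metric.ball x₀ (r / 2)) := by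
    intro y hy
    by_cases h : y ∈ Metric.ball x₀ r
    · exact Or.inr ⟨h, hy⟩
    · exact Or.inl h
  refine (lintegral_mono_set hsub).trans ((lintegral_union_le _ _ _).trans ?_)
  gcongr
  rw [← lintegral_const_mul' _ _ ENNReal.ofReal_ne_top]
  calc _ ≤ ∫⁻ y in Metric.ball x₀ r \ Metric.ball x₀ (r / 2),
        ENNReal.ofReal ((r / 2) ^ (-p)) * ENNReal.ofReal (u y) := by
        refine setLIntegral_mono' (measurableSet_ball.diff measurableSet_ball) fun y hy => ?_
        rw [mul_comm]
        gcongr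
        refine ker_le_of_le_norm hp (by positivity) ?_
        have := hy.2
        rwa [Metric.mem_ball, not_lt, dist_eq_norm] at this
    _ ≤ _ := lintegral_mono_set sdiff_subset

/-- Outside the unit ball the kernel is at most `1` and integrable, so `u ≤ 1 + u²` suffices. The
bound is the same for all normalized `u` and all centres. -/
theorem tail_one_le {n : ℕ} {σ : ℝ} (hσ : 0 < σ) {u : EuclideanSpace ℝ (Fin n) → ℝ}
    (hu2 : ∫⁻ x, ENNReal.ofReal (u x ^ 2) = 1) (x₀ : EuclideanSpace ℝ (Fin n)) :
    ∫⁻ y in (Metric.ball x₀ 1)ᶜ, ENNReal.ofReal (u y) * ker ((n : ℝ) + 2 * σ) (y - x₀) ≤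
      kerConst n σ + 1 := by
  set p := (n : ℝ) + 2 * σ
  have hp : 0 ≤ p := by positivity
  calc _ ≤ ∫⁻ y in (Metric.ball x₀ 1)ᶜ, (ENNReal.ofReal (min 1 (‖x₀ - y‖ ^ 2 / 1 ^ 2)) *
        ker p (x₀ - y) + ENNReal.ofReal (u y ^ 2)) := by
        refine setLIntegral_mono' measurableSet_ball.compl fun y hy => ?_
        rw [mem_compl_iff, Metric.mem_ball, not_lt, dist_eq_norm] at hy
        have hk : ker p (y - x₀) ≤ 1 := by
          simpa using ker_le_of_le_norm hp one_pos hy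
        have hmin : min 1 (‖x₀ - y‖ ^ 2 / 1 ^ 2) = 1 := by
          rw [norm_sub_rev, one_pow, div_one]
          exact min_eq_left (by nlinarith)
        rw [hmin, ENNReal.ofReal_one, ker_sub_comm p x₀ y]
        have h1 : ENNReal.ofReal (u y) ≤ 1 + ENNReal.ofReal (u y ^ 2) := by
          rw [← ENNReal.ofReal_one, ← ENNReal.ofReal_add zero_le_one (sq_nonneg _)]
          apply ENNReal.ofReal_le_ofReal
          nlinarith [sq_nonneg (u y - 1)]
        calc _ ≤ (1 + ENNReal.ofReal (u y ^ 2)) * ker p (y - x₀) := by gcongr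
          _ = 1 * ker p (y - x₀) + ENNReal.ofReal (u y ^ 2) * ker p (y - x₀) := add_mul _ _ _
          _ ≤ _ := by
            gcongr
            exact mul_le_of_le_one_right bot_le hk
    _ ≤ ∫⁻ y, (ENNReal.ofReal (min 1 (‖x₀ - y‖ ^ 2 / 1 ^ 2)) *
        ker p (x₀ - y) + ENNReal.ofReal (u y ^ 2)) := setLIntegral_le_lintegral _ _
    _ = _ := by
        rw [lintegral_add_left (by fun_prop), hu2, lintegral_min_mul_ker_sub σ one_pos]
        simp

/-- The order of choice matters: `s` is taken large in terms of `C` and `τ`, then `κ` small in terms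
of `s`, and `θ` is forced by `s ^ 2 * θ = κ ^ n * ω / 2`. The last three conditions propagate the
bounds on the measure, on `U` and on `T`, in this order. -/
theorem exists_iteration_constants {n : ℕ} (hn : 2 ≤ n) {σ C ω τ : ℝ} (hσ : 1 / 2 < σ)
    (hC : 0 < C) (hω : 0 < ω) (hτ : 1 ≤ τ) :
    ∃ s κ θ : ℝ, 0 < s ∧ 0 < κ ∧ κ ≤ 1 ∧ 0 < θ ∧ θ ≤ 1 / 2 ∧ s ^ 2 * θ = κ ^ n * ω / 2 ∧
      C * 2 ^ n * (1 + s * τ) ≤ s ^ 2 ∧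
      C * κ ^ (2 * σ) * (1 + s * τ) * 2 ^ ((n : ℝ) + 2 * σ) ≤ 1 ∧
      2 ^ ((n : ℝ) + 2 * σ) * (s * θ) ≤ (2 ^ σ - 1) * τ := by
  set P : ℝ := 2 ^ ((n : ℝ) + 2 * σ) with hP
  have hP0 : 0 < P := by positivity
  set s : ℝ := C * 2 ^ n * (1 + τ) + 1 with hs
  have hs1 : 1 ≤ s := by rw [hs]; linarith [show 0 ≤ C * 2 ^ n * (1 + τ) by positivity]
  set D : ℝ := 1 + C * (1 + s * τ) * P + 2 * P * ω + ω with hD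
  have hsτ : 0 < 1 + s * τ := by positivity
  have hD1 : 1 ≤ D := by
    have : 0 ≤ C * (1 + s * τ) * P + 2 * P * ω + ω := by positivity
    rw [hD]; linarith
  have hDpos : 0 < D := by linarith
  have hκ : 0 < 1 / D := by positivity
  have hκ1 : 1 / D ≤ 1 := by rw [div_le_one hDpos]; exact hD1
  have k1 : C * (1 / D) * (1 + s * τ) * P ≤ 1 := by
    rw [show C * (1 / D) * (1 + s * τ) * P = (C * (1 + s * τ) * P) / D by ring, div_le_one hDpos]
    have : 0 ≤ 2 * P * ω + ω := by positivity
    rw [hD]; linarith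
  have k2 : 2 * P * ω * (1 / D) ≤ 1 := by
    rw [mul_one_div, div_le_one hDpos]
    have : 0 ≤ C * (1 + s * τ) * P + ω := by positivity
    rw [hD]; linarith
  have k3 : ω * (1 / D) ≤ 1 := by
    rw [mul_one_div, div_le_one hDpos]
    have : 0 ≤ C * (1 + s * τ) * P + 2 * P * ω := by positivity
    rw [hD]; linarith
  generalize 1 / D = κ at *
  have hκn : κ ^ n ≤ κ := pow_le_of_le_one hκ.le hκ1 (by omega)
  have hκσ : κ ^ (2 * σ) ≤ κ := by
    conv_rhs => rw [← Real.rpow_one κ]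
    exact Real.rpow_le_rpow_of_exponent_ge hκ hκ1 (by linarith)
  have h2σ : (1.4 : ℝ) ≤ 2 ^ σ := by
    have h1 : (2 : ℝ) ≤ (2 ^ σ) ^ 2 := by
      rw [← Real.rpow_natCast, ← Real.rpow_mul (by norm_num)]
      conv_lhs => rw [← Real.rpow_one 2]
      apply Real.rpow_le_rpow_of_exponent_le (by norm_num)
      push_cast; linarith
    have h2 : (0 : ℝ) < 2 ^ σ := by positivity
    nlinarith
  have hsθ : s * (κ ^ n * ω / (2 * s ^ 2)) ≤ κ * ω / 2 := by
    have : s * (κ ^ n * ω / (2 * s ^ 2)) = (κ ^ n * ω / 2) / s := by field_simp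
    rw [this]
    refine (div_le_self (by positivity) hs1).trans ?_
    gcongr
  have hθ : κ ^ n * ω / (2 * s ^ 2) ≤ κ * ω / 2 := by
    refine le_trans ?_ hsθ
    exact le_mul_of_one_le_left (by positivity) hs1
  refine ⟨s, κ, κ ^ n * ω / (2 * s ^ 2), by linarith, hκ, hκ1, by positivity, by linarith,
    by field_simp, ?_, ?_, ?_⟩
  · have h1 : 0 < C * 2 ^ n := by positivity
    have h2 : C * 2 ^ n * (1 + s * τ) ≤ C * 2 ^ n * (s * (1 + τ)) := by
      gcongr; nlinarith
    nlinarith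
  · refine le_trans ?_ k1
    gcongr
  · have : P * (s * (κ ^ n * ω / (2 * s ^ 2))) ≤ P * (κ * ω / 2) := by gcongr
    nlinarith

namespace IsNormalizedMinimizer

set_option maxHeartbeats 1000000 in
/-- Smallness of a normalized minimizer on a unit ball forces the positivity
set to have density at most `1/2` at the center, along dyadic radii. -/
theorem exists_density_le (n : ℕ) (hn : 2 ≤ n) {σ : ℝ} (hσ : 1 / 2 < σ) (hσ1 : σ < 1)
    {C₀ : ℝ≥0∞} (hC₀ : C₀ ≠ ⊤) :
    ∃ c : ℝ, 0 < c ∧ c < 1 ∧ ∀ (N : ℝ) (u : EuclideanSpace ℝ (Fin n) → ℝ),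
      IsNormalizedMinimizer σ N u → m n σ N ≤ C₀ → ∀ x₀ : EuclideanSpace ℝ (Fin n),
      (∀ᵐ y ∂(volume.restrict (Metric.ball x₀ 1)), u y ≤ c) → ∀ j : ℕ,
        volume ({x | 0 < u x} ∩ Metric.ball x₀ ((1 / 2) ^ (j + 1))) ≤
          ENNReal.ofReal (((1 / 2) ^ (j + 1)) ^ n * unitVol n / 2) := by
  obtain ⟨C, hC, hstep⟩ := exists_step n hn hσ hσ1 hC₀
  have hJ := (kerConst_lt_top hn (by linarith : 0 < σ) hσ1).ne
  have hω := unitVol_pos n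
  set ω := unitVol n
  set τ₁ : ℝ := (kerConst n σ).toReal + 1 with hτ₁
  have hτ₁1 : 1 ≤ τ₁ := by rw [hτ₁]; linarith [ENNReal.toReal_nonneg (a := kerConst n σ)]
  -- The extra `1` pays for the mass that enters the tail between radii `1` and `1/2`.
  set τ : ℝ := τ₁ + 1 with hτ
  have hτ1 : 1 ≤ τ := by linarith
  obtain ⟨s, κ, θ, hs, hκ, hκ1, hθ, hθ2, hα, hc1, hc2, hc3⟩ :=
    exists_iteration_constants hn hσ hC hω hτ1
  set p : ℝ := (n : ℝ) + 2 * σ with hp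
  have hp0 : 0 < p := by positivity
  set α : ℝ := s ^ 2 * θ with hαdef
  have hα0 : 0 < α := by positivity
  have hαω : α ≤ ω / 2 := by
    rw [hα]
    have : κ ^ n ≤ 1 := pow_le_one₀ hκ.le hκ1
    nlinarith
  -- the smallness threshold
  set D : ℝ := 2 + 2 * ω + C * ω * (1 + τ₁) * 2 ^ n / α + ω * 2 ^ p / θ + 2 ^ p * ω with hD
  have hq1 : 0 < C * ω * (1 + τ₁) * 2 ^ n / α := by positivity
  have hq2 : 0 < ω * 2 ^ p / θ := by positivity
  have hq3 : 0 < 2 ^ p * ω := by positivity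
  have hDpos : 0 < D := by positivity
  have hcD : 0 < 1 / D := by positivity
  have b1 : 1 / D ≤ 1 / 2 := one_div_le_one_div_of_le two_pos (by rw [hD]; linarith)
  have b2 : 2 * ω * (1 / D) ≤ 1 := by
    rw [mul_one_div, div_le_one hDpos, hD]; linarith
  have b3 : C * ω * (1 + τ₁) * 2 ^ n * (1 / D) ≤ α := by
    rw [mul_one_div, div_le_iff₀ hDpos, ← div_le_iff₀' hα0, hD]; linarith
  have b4 : ω * 2 ^ p * (1 / D) ≤ θ := by
    rw [mul_one_div, div_le_iff₀ hDpos, ← div_le_iff₀' hθ, hD]; linarith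
  have b5 : 2 ^ p * ω * (1 / D) ≤ 1 := by
    rw [mul_one_div, div_le_one hDpos, hD]; linarith
  generalize 1 / D = c at *
  refine ⟨c, hcD, by linarith, fun N u hu hm x₀ hsmall => ?_⟩
  set U : ℝ → ℝ≥0∞ := fun r => ∫⁻ x in Metric.ball x₀ r, ENNReal.ofReal (u x ^ 2) with hU
  set V : ℝ → ℝ≥0∞ := fun r => ∫⁻ x in Metric.ball x₀ r, ENNReal.ofReal (u x) with hV
  set T : ℝ → ℝ≥0∞ := fun r =>
    ∫⁻ y in (Metric.ball x₀ r)ᶜ, ENNReal.ofReal (u y) * ker p (y - x₀) with hT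
  set a : ℝ → ℝ≥0∞ := fun r => volume ({x | 0 < u x} ∩ Metric.ball x₀ r) with ha
  have hstep' : ∀ r : ℝ, 0 < r → r ≤ 1 → U r ≤ 1 / 2 → ∀ E : ℝ≥0∞,
      ENNReal.ofReal (r ^ (-(2 * σ))) * U r + V r * T r ≤ E →
      a (r / 2) ≤ ENNReal.ofReal C * E ∧ ∀ κ : ℝ, 0 < κ →
        a r ≤ ENNReal.ofReal ((κ * r) ^ n * ω / 2) →
        U (r / 2) ≤ ENNReal.ofReal (C * (κ * r) ^ (2 * σ)) * E :=
    fun r hr hr1 hU2 E hE => hstep N u hu hm x₀ r hr hr1 hU2 E hE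
  have hTstep : ∀ r : ℝ, 0 < r → T (r / 2) ≤ T r + ENNReal.ofReal ((r / 2) ^ (-p)) * V r :=
    fun r hr => tail_half_le hp0.le hr
  have hVle : ∀ r A B s : ℝ, 0 ≤ A → 0 ≤ B → 0 < s → U r ≤ ENNReal.ofReal A →
      a r ≤ ENNReal.ofReal B → V r ≤ ENNReal.ofReal ((s * A + B / s) / 2) :=
    fun r A B s hA hB hs h1 h2 => setLIntegral_le_of_sq_le hu.measurable hA hB hs h1 h2
  have hhalf : ENNReal.ofReal (1 / 2) = 1 / 2 := by
    rw [ENNReal.ofReal_div_of_pos two_pos]; simp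
  have inv_step : ∀ r : ℝ, 0 < r → r ≤ 1 →
      (U r ≤ ENNReal.ofReal (θ * r ^ p) ∧ a r ≤ ENNReal.ofReal (α * r ^ n) ∧
        T r ≤ ENNReal.ofReal (τ * r ^ (-σ))) →
      (U (r / 2) ≤ ENNReal.ofReal (θ * (r / 2) ^ p) ∧
        a (r / 2) ≤ ENNReal.ofReal (α * (r / 2) ^ n) ∧
        T (r / 2) ≤ ENNReal.ofReal (τ * (r / 2) ^ (-σ))) := by
    rintro r hr hr1 ⟨h1, h2, h3⟩
    have hVr : V r ≤ ENNReal.ofReal (s * θ * r ^ ((n : ℝ) + σ)) := by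
      -- With this weight, and `α = s² θ`, the two halves of Young's inequality coincide.
      refine (hVle r _ _ (s * r ^ (-σ)) (by positivity) (by positivity) (by positivity)
        h1 h2).trans (le_of_eq ?_)
      congr 1
      have e1 : r ^ (-σ) * r ^ p = r ^ ((n : ℝ) + σ) := by
        rw [← Real.rpow_add hr]; congr 1; rw [hp]; ring
      have e2 : r ^ n / r ^ (-σ) = r ^ ((n : ℝ) + σ) := by
        rw [← Real.rpow_natCast, ← Real.rpow_sub hr]; congr 1; ring
      have e3 : α * r ^ n / (s * r ^ (-σ)) = s * θ * (r ^ n / r ^ (-σ)) := by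
        rw [hαdef]; field_simp
      rw [e3, e2]
      linear_combination (s * θ / 2) * e1
    have hE : ENNReal.ofReal (r ^ (-(2 * σ))) * U r + V r * T r ≤
        ENNReal.ofReal (θ * (1 + s * τ) * r ^ n) := by
      calc _ ≤ ENNReal.ofReal (r ^ (-(2 * σ))) * ENNReal.ofReal (θ * r ^ p) +
            ENNReal.ofReal (s * θ * r ^ ((n : ℝ) + σ)) * ENNReal.ofReal (τ * r ^ (-σ)) := by
            gcongr
        _ = _ := by
            rw [← ENNReal.ofReal_mul (by positivity), ← ENNReal.ofReal_mul (by positivity),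
              ← ENNReal.ofReal_add (by positivity) (by positivity)]
            congr 1
            have e1 : r ^ (-(2 * σ)) * r ^ p = r ^ n := by
              rw [← Real.rpow_natCast, ← Real.rpow_add hr]; congr 1; rw [hp]; ring
            have e2 : r ^ ((n : ℝ) + σ) * r ^ (-σ) = r ^ n := by
              rw [← Real.rpow_natCast, ← Real.rpow_add hr]; congr 1; ring
            linear_combination θ * e1 + s * θ * τ * e2
    have hUhalf : U r ≤ 1 / 2 := by
      refine h1.trans ?_
      rw [← hhalf]
      apply ENNReal.ofReal_le_ofReal
      have : r ^ p ≤ 1 := Real.rpow_le_one hr.le hr1 hp0.le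
      nlinarith
    obtain ⟨g1, g2⟩ := hstep' r hr hr1 hUhalf _ hE
    -- The measure bound is that of half a ball of radius `κ r`, so Faber–Krahn gains the factor
    -- `κ^(2σ)` that beats `C`.
    have hακ : a r ≤ ENNReal.ofReal ((κ * r) ^ n * ω / 2) := by
      refine h2.trans (le_of_eq ?_)
      rw [hα, mul_pow]
      congr 1; ring
    refine ⟨(g2 κ hκ hακ).trans ?_, g1.trans ?_, (hTstep r hr).trans ?_⟩
    · rw [← ENNReal.ofReal_mul (by positivity)]
      apply ENNReal.ofReal_le_ofReal
      rw [Real.div_rpow hr.le two_pos.le, Real.mul_rpow hκ.le hr.le, ← mul_div_assoc,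
        le_div_iff₀ (by positivity)]
      have e1 : r ^ (2 * σ) * r ^ n = r ^ p := by
        rw [← Real.rpow_natCast, ← Real.rpow_add hr]; congr 1; rw [hp]; ring
      calc _ = (C * κ ^ (2 * σ) * (1 + s * τ) * 2 ^ p) * (θ * (r ^ (2 * σ) * r ^ n)) := by ring
        _ ≤ 1 * (θ * r ^ p) := by rw [e1]; gcongr
        _ = _ := one_mul _
    · rw [← ENNReal.ofReal_mul hC.le]
      apply ENNReal.ofReal_le_ofReal
      rw [div_pow, ← mul_div_assoc, le_div_iff₀ (by positivity), hαdef]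
      calc _ = (C * 2 ^ n * (1 + s * τ)) * (θ * r ^ n) := by ring
        _ ≤ s ^ 2 * (θ * r ^ n) := by gcongr
        _ = _ := by ring
    · calc _ ≤ ENNReal.ofReal (τ * r ^ (-σ)) + ENNReal.ofReal ((r / 2) ^ (-p)) *
            ENNReal.ofReal (s * θ * r ^ ((n : ℝ) + σ)) := by gcongr
        _ ≤ _ := by
          rw [← ENNReal.ofReal_mul (by positivity), ← ENNReal.ofReal_add (by positivity)
            (by positivity)]
          apply ENNReal.ofReal_le_ofReal
          have e1 : r ^ (-p) * r ^ ((n : ℝ) + σ) = r ^ (-σ) := by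
            rw [← Real.rpow_add hr]; congr 1; rw [hp]; ring
          have e2 : (r / 2) ^ (-p) = 2 ^ p * r ^ (-p) := by
            rw [Real.div_rpow hr.le two_pos.le, Real.rpow_neg two_pos.le, div_inv_eq_mul, mul_comm]
          have e3 : (r / 2) ^ (-σ) = 2 ^ σ * r ^ (-σ) := by
            rw [Real.div_rpow hr.le two_pos.le, Real.rpow_neg two_pos.le, div_inv_eq_mul, mul_comm]
          rw [e2, e3]
          calc _ = τ * r ^ (-σ) + (2 ^ p * (s * θ)) * (r ^ (-p) * r ^ ((n : ℝ) + σ)) := by ring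
            _ ≤ τ * r ^ (-σ) + ((2 ^ σ - 1) * τ) * r ^ (-σ) := by rw [e1]; gcongr
            _ = _ := by ring
  have hv1 : volume (Metric.ball x₀ 1) = ENNReal.ofReal ω := by
    rw [volume_ball_eq_ofReal x₀ one_pos]; simp [ω]
  have hV1 : V 1 ≤ ENNReal.ofReal (c * ω) := by
    rw [ENNReal.ofReal_mul hcD.le, ← hv1, ← setLIntegral_const]
    refine lintegral_mono_ae ?_
    filter_upwards [hsmall] with y hy
    exact ENNReal.ofReal_le_ofReal hy
  have hU1 : U 1 ≤ ENNReal.ofReal (c * ω) := by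
    rw [ENNReal.ofReal_mul hcD.le, ← hv1, ← setLIntegral_const]
    refine lintegral_mono_ae ?_
    filter_upwards [hsmall] with y hy
    apply ENNReal.ofReal_le_ofReal
    nlinarith [hu.nonneg y]
  have hT1 : T 1 ≤ ENNReal.ofReal τ₁ := by
    refine (tail_one_le (by linarith : 0 < σ) hu.lintegral_sq x₀).trans (le_of_eq ?_)
    rw [hτ₁, ENNReal.ofReal_add ENNReal.toReal_nonneg zero_le_one, ENNReal.ofReal_toReal hJ]
    simp
  -- The induction starts at `1/2`: smallness of `u` says nothing about the size of its support in
  -- the unit ball, and one step from radius `1` is needed to make the measure small.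
  have base : U (1 / 2) ≤ ENNReal.ofReal (θ * (1 / 2) ^ p) ∧
      a (1 / 2) ≤ ENNReal.ofReal (α * (1 / 2) ^ n) ∧
      T (1 / 2) ≤ ENNReal.ofReal (τ * (1 / 2) ^ (-σ)) := by
    have hUhalf : U 1 ≤ 1 / 2 := by
      refine hU1.trans ?_
      rw [← hhalf]
      apply ENNReal.ofReal_le_ofReal
      linarith
    have hE : ENNReal.ofReal (1 ^ (-(2 * σ))) * U 1 + V 1 * T 1 ≤
        ENNReal.ofReal (c * ω * (1 + τ₁)) := by
      calc _ ≤ ENNReal.ofReal 1 * ENNReal.ofReal (c * ω) +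
            ENNReal.ofReal (c * ω) * ENNReal.ofReal τ₁ := by
            rw [Real.one_rpow]; gcongr
        _ = _ := by
            rw [← ENNReal.ofReal_mul (by positivity), ← ENNReal.ofReal_mul (by positivity),
              ← ENNReal.ofReal_add (by positivity) (by positivity)]
            congr 1; ring
    have g1 := (hstep' 1 one_pos le_rfl hUhalf _ hE).1
    have g3 := hTstep 1 one_pos
    refine ⟨?_, g1.trans ?_, g3.trans ?_⟩
    · refine (lintegral_mono_set (Metric.ball_subset_ball (by norm_num))).trans (hU1.trans ?_)
      apply ENNReal.ofReal_le_ofReal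
      rw [Real.div_rpow zero_le_one two_pos.le, Real.one_rpow, mul_one_div,
        le_div_iff₀ (by positivity)]
      linarith
    · rw [← ENNReal.ofReal_mul hC.le]
      apply ENNReal.ofReal_le_ofReal
      rw [div_pow, one_pow, mul_one_div, le_div_iff₀ (by positivity)]
      linarith
    · calc _ ≤ ENNReal.ofReal τ₁ + ENNReal.ofReal ((1 / 2) ^ (-p)) *
            ENNReal.ofReal (c * ω) := by gcongr
        _ ≤ _ := by
          rw [← ENNReal.ofReal_mul (by positivity), ← ENNReal.ofReal_add (by positivity)
            (by positivity)]
          apply ENNReal.ofReal_le_ofReal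
          have e : ∀ q : ℝ, (1 / 2 : ℝ) ^ (-q) = 2 ^ q := fun q => by
            rw [one_div, Real.inv_rpow two_pos.le, Real.rpow_neg two_pos.le, inv_inv]
          rw [e, e]
          have h1 : (1 : ℝ) ≤ 2 ^ σ := Real.one_le_rpow (by norm_num) (by linarith)
          nlinarith
  have hind : ∀ j : ℕ, U ((1 / 2) ^ (j + 1)) ≤ ENNReal.ofReal (θ * ((1 / 2) ^ (j + 1)) ^ p) ∧
      a ((1 / 2) ^ (j + 1)) ≤ ENNReal.ofReal (α * ((1 / 2) ^ (j + 1)) ^ n) ∧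
      T ((1 / 2) ^ (j + 1)) ≤ ENNReal.ofReal (τ * ((1 / 2) ^ (j + 1)) ^ (-σ)) := by
    intro j
    induction j with
    | zero => simpa using base
    | succ j ih =>
      have := inv_step ((1 / 2) ^ (j + 1)) (by positivity)
        (pow_le_one₀ (by norm_num) (by norm_num)) ih
      rwa [show (1 / 2 : ℝ) ^ (j + 1) / 2 = (1 / 2) ^ (j + 1 + 1) by ring] at this
  intro j
  refine (hind j).2.1.trans (ENNReal.ofReal_le_ofReal ?_)
  have : 0 ≤ ((1 / 2 : ℝ) ^ (j + 1)) ^ n := by positivity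
  nlinarith

end IsNormalizedMinimizer

/-! ### Bound on `m(N)`, good representatives, Lebesgue points, small containers. -/

/-- One fixed bump supported in the ball of radius `1/4` is a competitor for every such `N`. -/
theorem exists_m_le {n : ℕ} (hn : 2 ≤ n) {σ : ℝ} (hσ : 0 < σ) (hσ1 : σ < 1) :
    ∃ C₀ : ℝ≥0∞, C₀ ≠ ⊤ ∧ ∀ N : ℝ, 1 / 2 ≤ N → m n σ N ≤ C₀ := by
  let χ : ContDiffBump (0 : EuclideanSpace ℝ (Fin n)) := ⟨1 / 8, 1 / 4, by norm_num, by norm_num⟩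
  have hχ : ContDiff ℝ 1 χ := χ.contDiff
  have hfin := energy_univ_ne_top_of_hasCompactSupport hn hσ hσ1 hχ χ.hasCompactSupport
  have hmχ : Measurable χ := χ.continuous.measurable
  have hpos : ∫⁻ x in Metric.ball (0 : EuclideanSpace ℝ (Fin n)) (1 / 2),
      ENNReal.ofReal (χ x ^ 2) ≠ 0 := by
    have h1 : volume (Metric.ball (0 : EuclideanSpace ℝ (Fin n)) (1 / 8)) ≤
        ∫⁻ x in Metric.ball (0 : EuclideanSpace ℝ (Fin n)) (1 / 2), ENNReal.ofReal (χ x ^ 2) := by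
      rw [← setLIntegral_one]
      refine le_trans ?_ (lintegral_mono_set (Metric.ball_subset_ball (by norm_num :
        (1 / 8 : ℝ) ≤ 1 / 2)))
      refine setLIntegral_mono' measurableSet_ball fun x hx => ?_
      rw [χ.one_of_mem_closedBall (Metric.ball_subset_closedBall hx)]
      simp
    exact ((Metric.measure_ball_pos volume _ (by norm_num)).trans_le h1).ne'
  have hsupp : ∀ x, 0 < χ x → x ∈ Metric.ball (0 : EuclideanSpace ℝ (Fin n)) (1 / 2) := by
    intro x hx
    by_contra h
    rw [Metric.mem_ball, not_lt] at h
    have : χ x = 0 := χ.zero_of_le_dist (le_trans (by show (1 / 4 : ℝ) ≤ 1 / 2; norm_num) h)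
    linarith
  refine ⟨energy σ univ χ / (∫⁻ x in Metric.ball (0 : EuclideanSpace ℝ (Fin n)) (1 / 2),
    ENNReal.ofReal (χ x ^ 2)) + volume (Metric.ball (0 : EuclideanSpace ℝ (Fin n)) (1 / 2)),
    ENNReal.add_ne_top.2 ⟨ENNReal.div_ne_top hfin hpos, measure_ball_lt_top.ne⟩, fun N hN => ?_⟩
  have hadm : Admissible σ N χ := by
    refine ⟨⟨hmχ.aestronglyMeasurable, fun _ => χ, fun _ => ⟨hχ, χ.hasCompactSupport, ?_⟩, ?_, ?_⟩,
      fun h => hpos ?_, Eventually.of_forall fun x => χ.nonneg⟩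
    · rw [χ.tsupport_eq]
      refine Metric.closedBall_subset_ball ?_
      show (1 / 4 : ℝ) < N
      linarith
    · simp [energy]
    · simp
    · rw [lintegral_eq_zero_iff (by fun_prop)]
      filter_upwards [ae_restrict_of_ae h] with x hx
      simp [hx]
  refine (sInf_le ⟨_, hadm, rfl⟩ : m n σ N ≤ functional σ N χ).trans ?_
  unfold functional
  gcongr
  · exact energy_mono_set (subset_univ _) _
  · exact fun x hx => hsupp x hx

theorem energy_congr_ae {n : ℕ} {σ : ℝ} {E F : Set (EuclideanSpace ℝ (Fin n))}
    {u v : EuclideanSpace ℝ (Fin n) → ℝ} (hEF : E =ᵐ[volume] F) (huv : u =ᵐ[volume] v) :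
    energy σ E u = energy σ F v := by
  unfold energy
  rw [Measure.restrict_congr_set hEF]
  refine lintegral_congr_ae ?_
  filter_upwards [ae_restrict_of_ae huv] with x hx
  refine lintegral_congr_ae ?_
  filter_upwards [ae_restrict_of_ae huv] with y hy
  rw [hx, hy]

theorem MemHo.congr_ae {n : ℕ} {σ : ℝ} {Ω : Set (EuclideanSpace ℝ (Fin n))}
    {u v : EuclideanSpace ℝ (Fin n) → ℝ} (hu : MemHo σ Ω u) (huv : u =ᵐ[volume] v) :
    MemHo σ Ω v := by
  obtain ⟨hm, φ, hφ, hE, hL⟩ := hu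
  refine ⟨hm.congr huv, φ, hφ, ?_, ?_⟩
  · refine hE.congr fun k => energy_congr_ae (ae_eq_refl _) (EventuallyEq.rfl.sub huv)
  · refine hL.congr fun k => eLpNorm_congr_ae (EventuallyEq.rfl.sub huv)

theorem lintegral_sq_eq_one {n : ℕ} {u : EuclideanSpace ℝ (Fin n) → ℝ}
    (h : ∫ y, u y ^ 2 = 1) : ∫⁻ y, ENNReal.ofReal (u y ^ 2) = 1 := by
  have hi : Integrable fun y => u y ^ 2 := by
    -- A non-integrable square would have Bochner integral `0`, not `1`.
    by_contra hi
    rw [integral_undef hi] at h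
    exact zero_ne_one h
  rw [← ofReal_integral_eq_lintegral_ofReal hi (Eventually.of_forall fun y => sq_nonneg _), h,
    ENNReal.ofReal_one]

theorem setOf_pos_ae_eq {n : ℕ} {u v : EuclideanSpace ℝ (Fin n) → ℝ} (huv : u =ᵐ[volume] v) :
    ({x | 0 < u x} : Set (EuclideanSpace ℝ (Fin n))) =ᵐ[volume] {x | 0 < v x} := by
  filter_upwards [huv] with x hx
  exact propext (by show 0 < u x ↔ 0 < v x; rw [hx])

theorem IsMinimizer.exists_isNormalizedMinimizer {n : ℕ} (hn : 2 ≤ n) {σ N : ℝ} (hσ : 0 < σ)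
    (hσ1 : σ < 1) {u : EuclideanSpace ℝ (Fin n) → ℝ} (hu : IsMinimizer σ N u)
    (hu1 : ∫ y, u y ^ 2 = 1) : ∃ v, IsNormalizedMinimizer σ N v ∧ u =ᵐ[volume] v := by
  obtain ⟨⟨hmem, -, hnn⟩, hmin⟩ := hu
  have hz := hmem.ae_eq_zero hn hσ hσ1 measurableSet_ball
  have hum := hmem.1.aemeasurable
  set v : EuclideanSpace ℝ (Fin n) → ℝ :=
    (Metric.ball 0 N).indicator fun x => max (hum.mk u x) 0 with hv
  have hmv : Measurable v := (hum.measurable_mk.max measurable_const).indicator measurableSet_ball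
  have huv : u =ᵐ[volume] v := by
    rw [ae_restrict_iff' measurableSet_ball] at hnn
    filter_upwards [hz, hnn, hum.ae_eq_mk] with x h1 h2 h3
    by_cases hx : x ∈ Metric.ball (0 : EuclideanSpace ℝ (Fin n)) N
    · rw [hv, indicator_of_mem hx, ← h3, max_eq_left (h2 hx)]
    · rw [hv, indicator_of_notMem hx, h1 hx]
  have hv0 : ∀ x ∉ Metric.ball (0 : EuclideanSpace ℝ (Fin n)) N, v x = 0 :=
    fun x hx => indicator_of_notMem hx _
  have hsq : ∫⁻ x, ENNReal.ofReal (v x ^ 2) = 1 := by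
    rw [← lintegral_sq_eq_one hu1]
    refine lintegral_congr_ae ?_
    filter_upwards [huv] with x hx
    rw [hx]
  have hsqB : ∫⁻ x in Metric.ball 0 N, ENNReal.ofReal (u x ^ 2) = 1 := by
    rw [← hsq, ← setLIntegral_eq_of_support_subset (s := Metric.ball 0 N)
      (f := fun x => ENNReal.ofReal (v x ^ 2))]
    · refine lintegral_congr_ae ?_
      filter_upwards [ae_restrict_of_ae huv] with x hx
      rw [hx]
    · intro x hx
      by_contra h
      simp [hv0 x h] at hx
  refine ⟨v, ⟨hmv, fun x => ?_, hv0, hmem.congr_ae huv, hsq, ?_⟩, huv⟩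
  · exact indicator_nonneg (fun _ _ => le_max_right _ _) x
  · rw [← hmin, functional, hsqB, div_one, energy_congr_ae (setOf_pos_ae_eq huv) huv,
      measure_congr (setOf_pos_ae_eq huv)]

theorem IsLebesguePoint.congr_ae {n : ℕ} {E F : Set (EuclideanSpace ℝ (Fin n))}
    {x : EuclideanSpace ℝ (Fin n)} (hE : IsLebesguePoint E x) (hEF : E =ᵐ[volume] F) :
    IsLebesguePoint F x := by
  refine hE.congr fun r => ?_
  rw [measure_congr (hEF.inter (ae_eq_refl (Metric.ball x r)))]

theorem IsLebesguePoint.mem_closure {n : ℕ} {E : Set (EuclideanSpace ℝ (Fin n))}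
    {x : EuclideanSpace ℝ (Fin n)} (hE : IsLebesguePoint E x) : x ∈ closure E := by
  by_contra h
  obtain ⟨ε, hε, hd⟩ := Metric.isOpen_iff.1 isClosed_closure.isOpen_compl x h
  have h0 : Tendsto (fun r : ℝ => volume (E ∩ Metric.ball x r) / volume (Metric.ball x r))
      (𝓝[>] 0) (𝓝 0) := by
    refine tendsto_const_nhds.congr' ?_
    filter_upwards [Ioo_mem_nhdsGT hε] with r hr
    have : E ∩ Metric.ball x r = ∅ := by
      rw [eq_empty_iff_forall_notMem]
      rintro y ⟨hy1, hy2⟩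
      exact hd (Metric.ball_subset_ball hr.2.le hy2) (subset_closure hy1)
    simp [this]
  exact zero_ne_one (tendsto_nhds_unique h0 hE)

theorem IsLebesguePoint.not_forall_density_le {n : ℕ} {E : Set (EuclideanSpace ℝ (Fin n))}
    {x : EuclideanSpace ℝ (Fin n)} (hE : IsLebesguePoint E x) :
    ¬ ∀ j : ℕ, volume (E ∩ Metric.ball x ((1 / 2) ^ (j + 1))) ≤
      ENNReal.ofReal (((1 / 2) ^ (j + 1)) ^ n * unitVol n / 2) := by
  intro h
  have hr : Tendsto (fun j : ℕ => (1 / 2 : ℝ) ^ (j + 1)) atTop (𝓝[>] 0) := by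
    refine tendsto_nhdsWithin_iff.2 ⟨?_, Eventually.of_forall fun j => ?_⟩
    · exact (tendsto_pow_atTop_nhds_zero_of_lt_one (by norm_num) (by norm_num)).comp
        (tendsto_add_atTop_nat 1)
    · show (0 : ℝ) < _
      positivity
  have hω := unitVol_pos n
  have hle : (1 : ℝ≥0∞) ≤ ENNReal.ofReal (1 / 2) := by
    refine le_of_tendsto' (hE.comp hr) fun j => ?_
    simp only [Function.comp_apply]
    have hpos : 0 < (1 / 2 : ℝ) ^ (j + 1) := by positivity
    refine ENNReal.div_le_of_le_mul ((h j).trans (le_of_eq ?_))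
    rw [volume_ball_eq_ofReal x hpos, ← ENNReal.ofReal_mul (by norm_num)]
    congr 1
    ring
  rw [ENNReal.one_le_ofReal] at hle
  norm_num at hle

/-- Nondegeneracy when the container `B_N` is small. -/
theorem IsNormalizedMinimizer.one_le_of_ae_le {n : ℕ} {σ N : ℝ}
    {u : EuclideanSpace ℝ (Fin n) → ℝ} (hu : IsNormalizedMinimizer σ N u) (hN : N < 1 / 2)
    {x : EuclideanSpace ℝ (Fin n)} (hx : x ∈ closure {y | 0 < u y}) {c : ℝ}
    (h : ∀ᵐ y ∂(volume.restrict (Metric.ball x 1)), u y ≤ c) : 1 ≤ c ^ 2 * unitVol n := by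
  have hxN : ‖x‖ ≤ N := by
    have : x ∈ Metric.closedBall (0 : EuclideanSpace ℝ (Fin n)) N :=
      Metric.closure_ball_subset_closedBall (closure_mono hu.pos_subset hx)
    simpa using this
  -- `‖x‖ ≤ N` and `N < 1/2` give `N + ‖x‖ < 1`, so all the `L²` mass lies in the unit ball about
  -- `x`.
  have hsub : Metric.ball (0 : EuclideanSpace ℝ (Fin n)) N ⊆ Metric.ball x 1 := by
    refine Metric.ball_subset_ball' ?_
    rw [dist_zero_left]
    linarith
  have h1 : (1 : ℝ≥0∞) ≤ ENNReal.ofReal (c ^ 2 * unitVol n) := by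
    calc (1 : ℝ≥0∞) = ∫⁻ y in Metric.ball 0 N, ENNReal.ofReal (u y ^ 2) := hu.setLIntegral_sq.symm
      _ ≤ ∫⁻ y in Metric.ball x 1, ENNReal.ofReal (u y ^ 2) := lintegral_mono_set hsub
      _ ≤ ∫⁻ y in Metric.ball x 1, ENNReal.ofReal (c ^ 2) := by
          refine lintegral_mono_ae ?_
          filter_upwards [h] with y hy
          exact ENNReal.ofReal_le_ofReal (pow_le_pow_left₀ (hu.nonneg y) hy 2)
      _ = _ := by
          rw [setLIntegral_const, volume_ball_eq_ofReal x one_pos, ← ENNReal.ofReal_mul (sq_nonneg c)]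
          simp
  exact ENNReal.one_le_ofReal.1 h1

end FracFK

/-! ### Conclusion. -/

theorem mainTheorem5 (n : ℕ) (hn : 2 ≤ n) (σ : ℝ) (hσ : 1 / 2 < σ) (hσ1 : σ < 1) :
    ∃ c R₀ : ℝ, 0 < c ∧ c < 1 ∧ 0 < R₀ ∧ R₀ < 1 ∧
      ∀ N : ℝ, 0 < N →
        ∀ u : EuclideanSpace ℝ (Fin n) → ℝ,
          FracFK.IsMinimizer σ N u → ∫ y, u y ^ 2 = 1 →
            ∀ x : EuclideanSpace ℝ (Fin n), FracFK.IsLebesguePoint {y | 0 < u y} x →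
              ∃ R ∈ Set.Icc R₀ 1,
                ENNReal.ofReal (c * R ^ σ) ≤ FracFK.supOn (Metric.ball x R) u := by
  have hσ0 : 0 < σ := by linarith
  obtain ⟨C₀, hC₀, hm⟩ := FracFK.exists_m_le hn hσ0 hσ1
  obtain ⟨c, hc, hc1, hdens⟩ :=
    FracFK.IsNormalizedMinimizer.exists_density_le n hn hσ hσ1 hC₀
  have hω := FracFK.unitVol_pos n
  -- The first entry of the minimum serves `N ≥ 1/2`; the second has square times `unitVol n` below
  -- `1` and serves `N < 1/2`. The value `1/2` for `R₀` is arbitrary, as `R = 1` always works.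
  refine ⟨min c (1 / (2 * (1 + FracFK.unitVol n))), 1 / 2, lt_min hc (by positivity),
    (min_le_left _ _).trans_lt hc1, by norm_num, by norm_num, ?_⟩
  intro N hN u hu hu1 x hx
  refine ⟨1, ⟨by norm_num, le_rfl⟩, ?_⟩
  rw [Real.one_rpow, mul_one]
  by_contra hlt
  rw [not_le] at hlt
  obtain ⟨v, hv, huv⟩ := hu.exists_isNormalizedMinimizer hn hσ0 hσ1 hu1
  have hxv := hx.congr_ae (FracFK.setOf_pos_ae_eq huv)
  have hsmall : ∀ᵐ y ∂(volume.restrict (Metric.ball x 1)),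
      v y < min c (1 / (2 * (1 + FracFK.unitVol n))) := by
    filter_upwards [ae_lt_of_essSup_lt hlt, ae_restrict_of_ae huv] with y hy h
    rw [← h]
    exact (ENNReal.ofReal_lt_ofReal_iff (lt_min hc (by positivity))).1 hy
  rcases le_or_gt (1 / 2) N with hN2 | hN2
  · refine hxv.not_forall_density_le (hdens N v hv (hm N hN2) x ?_)
    filter_upwards [hsmall] with y hy
    exact (hy.trans_le (min_le_left _ _)).le
  · have h1 := hv.one_le_of_ae_le hN2 hxv.mem_closure (c := 1 / (2 * (1 + FracFK.unitVol n)))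
      (by filter_upwards [hsmall] with y hy; exact (hy.trans_le (min_le_right _ _)).le)
    have h2 : (1 / (2 * (1 + FracFK.unitVol n))) ^ 2 * FracFK.unitVol n < 1 := by
      rw [div_pow, one_pow, one_div_mul_eq_div, div_lt_one (by positivity)]
      nlinarith
    linarith
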